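/- Let $n\ge 1$, $G=\mathrm{SL}_n(\mathbb C)$, $T\subset B\subset G$ the diagonal torus and the upper triangular Borel subgroup, $W=\mathfrak S_n$ with simple reflections $s_1,\dots,s_{n-1}$, and let $P=P_J\supseteq B$ be the standard parabolic subgroup given by a set $J$ of simple reflections (for instance $J=\{s_i: i\ne d\}$, for which $G/P=\mathrm{Gr}(d,n)$). Let $W_P=\langle J\rangle$, let $W^P$ be the set of minimal length representatives of the cosets in $W/W_P$, let $\le$ be the Bruhat order, and for $w\in W^P$ let $X_w=\overline{BwP/P}\subseteq G/P$ and $X_w^B=\overline{BwB/B}\subseteq G/B$ be the Schubert varieties. A Schubert variety is called toric if it contains an open dense $T$-orbit. For a toric Schubert variety $X$, let $M_X$ be the lattice of those characters of $T$ that are trivial on the kernel of the action of $T$ on $X$; the fan of $X$ lies in $N_{X,\mathbb R}=\mathrm{Hom}_{\mathbb Z}(M_X,\mathbb R)$. Its maximal cone corresponding to a $T$-fixed point $y\in X$ is the cone $\sigma$ for which $U_\sigma=\operatorname{Spec}\mathbb C[\sigma^\vee\cap M_X]$ is the $T$-stable affine chart $\{z\in X: y\in\overline{Tz}\}$ of $X$;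 that is, $\sigma$ is the set of all $\nu\in N_{X,\mathbb R}$ with $\nu(\chi)\ge 0$ for every $\chi\in M_X$ for which there is a nonzero regular function $f$ on this chart with $f(tz)=\chi(t)f(z)$ for all $t\in T$. Let $w\in W^P$ be such that $X_w\subseteq G/P$ is toric. Then $X_w^B$ is toric and $M_{X_w}=M_{X_w^B}$, so that the fans of $X_w$ and of $X_w^B$ lie in the same real vector space. Moreover, for every $v\in W^P$ with $v\le w$, the maximal cone $C_v$ of the fan of $X_w$ corresponding to $vP$ and the maximal cones $C_u^B$ of the fan of $X_w^B$ corresponding to the fixed points $uB$ satisfy $$C_v=\bigcup_{u\in[v]}C_u^B,\qquad [v]=\{u\in\mathfrak S_n : u\le w,\ uW_P=vW_P\}.$$ -/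

import Mathlib

noncomputable section

open Matrix

namespace ToricSchubert

/-! ### The symmetric group `𝔖ₙ`, `n = r + 1`, as the Weyl group of type `A_r` -/

/-- The Weyl group: permutations of the `r + 1` coordinates. -/
abbrev Weyl (r : ℕ) : Type := Equiv.Perm (Fin (r + 1))

/-- The simple reflection `s_i`, exchanging the neighbours `i` and `i + 1`. -/
def simpleReflection {r : ℕ} (i : Fin r) : Weyl r := Equiv.swap i.castSucc i.succ

/-- The product `s_{i_1} ⋯ s_{i_m}` of a word in the simple reflections. -/
def wordProd {r : ℕ} (l : List (Fin r)) : Weyl r := (l.map simpleReflection).prod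

/-- The length `ℓ(w)`: the least number of letters of a word for `w`. -/
def length {r : ℕ} (w : Weyl r) : ℕ :=
  sInf {m : ℕ | ∃ l : List (Fin r), l.length = m ∧ wordProd l = w}

/-- `l` is a reduced word for `w`. -/
def IsReducedWord {r : ℕ} (l : List (Fin r)) (w : Weyl r) : Prop :=
  wordProd l = w ∧ l.length = length w

/-- The Bruhat order `u ≤ w`: some reduced word for `w` has a subword which is a reduced word
for `u`. -/
def BruhatLE {r : ℕ} (u w : Weyl r) : Prop :=
  ∃ l l' : List (Fin r), IsReducedWord l w ∧ l'.Sublist l ∧ IsReducedWord l' u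

/-- The parabolic subgroup `W_P` of the Weyl group generated by the `s_j` with `j ∈ J`. -/
def weylParabolic {r : ℕ} (J : Set (Fin r)) : Subgroup (Weyl r) :=
  Subgroup.closure (simpleReflection '' J)

/-- The set `W^P` of minimal length representatives of the left cosets of `W_P`. -/
def minCosetReps {r : ℕ} (J : Set (Fin r)) : Set (Weyl r) :=
  {w | ∀ u ∈ weylParabolic J, length w ≤ length (w * u)}

/-- The set `[v] = {u | u ≤ w, u W_P = v W_P}`. -/
def lifts {r : ℕ} (J : Set (Fin r)) (w v : Weyl r) : Set (Weyl r) :=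
  {u | BruhatLE u w ∧ (u : Weyl r ⧸ weylParabolic J) = (v : Weyl r ⧸ weylParabolic J)}

/-! ### The group `G = SLₙ(ℂ)`, its standard subgroups, and partial flag varieties -/

/-- The complex Lie group `G = SL_{r+1}(ℂ)`. -/
abbrev G (r : ℕ) : Type := Matrix.SpecialLinearGroup (Fin (r + 1)) ℂ

/-- The underlying matrix of an element of `G`. -/
abbrev mat {r : ℕ} (g : G r) : Matrix (Fin (r + 1)) (Fin (r + 1)) ℂ := g

/-- The standard parabolic subgroup `P_J`: the elements of `G` which preserve, for every `k ∉ J`,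
the span of the basis vectors with index at most `k` (`k` counted from `0`). -/
def parabolic {r : ℕ} (J : Set (Fin r)) : Subgroup (G r) where
  carrier := {g | ∀ k ∉ J, ∀ i j : Fin (r + 1), j ≤ k.castSucc → k.castSucc < i → mat g i j = 0}
  one_mem' := by
    intro k _ i j hj hi
    have h : i ≠ j := (lt_of_le_of_lt hj hi).ne'
    simp [h]
  mul_mem' := by
    intro a b ha hb k hk i j hj hi
    change (mat a * mat b) i j = 0
    rw [Matrix.mul_apply]
    refine Finset.sum_eq_zero fun l _ => ?_
    rcases le_or_gt l k.castSucc with h | h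
    · rw [ha k hk i l h hi, zero_mul]
    · rw [hb k hk l j hj h, mul_zero]
  inv_mem' := by
    intro a ha k hk i j hj hi
    have hdet : (mat a).det = 1 := a.2
    have hu : IsUnit (mat a).det := by rw [hdet]; exact isUnit_one
    have hbt : (mat a).BlockTriangular (fun i => decide (k.castSucc < i)) := by
      intro p q hpq
      have h1 : ¬ k.castSucc < q ∧ k.castSucc < p := by
        by_cases hq : k.castSucc < q
        · change decide (k.castSucc < q) < decide (k.castSucc < p) at hpq
          rw [decide_eq_true hq] at hpq
          exact absurd hpq (not_lt.mpr (Bool.le_true _))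
        · by_cases hp : k.castSucc < p
          · exact ⟨hq, hp⟩
          · simp [hq, hp] at hpq
      exact ha k hk p q (not_lt.mp h1.1) h1.2
    let _ := Matrix.invertibleOfIsUnitDet (mat a) hu
    have hinv := blockTriangular_inv_of_blockTriangular hbt
    have h2 : mat a⁻¹ = (mat a)⁻¹ := by
      rw [Matrix.inv_def, hdet, Ring.inverse_one, one_smul]
      exact (Matrix.SpecialLinearGroup.coe_inv a).symm
    change mat a⁻¹ i j = 0
    rw [h2]
    apply hinv
    have hj' : ¬ k.castSucc < j := not_lt.mpr hj
    simp [hj', hi]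

/-- The Borel subgroup `B = P_∅` of upper triangular matrices. -/
abbrev borel (r : ℕ) : Subgroup (G r) := parabolic (∅ : Set (Fin r))

/-- The maximal torus `T` of diagonal matrices. -/
def torus (r : ℕ) : Subgroup (G r) where
  carrier := {g | ∀ i j : Fin (r + 1), i ≠ j → mat g i j = 0}
  one_mem' := by
    intro i j h
    simp [h]
  mul_mem' := by
    intro a b ha hb i j hij
    change (mat a * mat b) i j = 0
    rw [Matrix.mul_apply]
    refine Finset.sum_eq_zero fun l _ => ?_
    by_cases h : i = l
    · rw [hb l j (h ▸ hij), mul_zero]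
    · rw [ha i l h, zero_mul]
  inv_mem' := by
    intro a ha i j hij
    have hd : mat a = Matrix.diagonal (fun i => mat a i i) := by
      ext p q
      by_cases h : p = q
      · subst h; simp
      · rw [ha p q h, Matrix.diagonal_apply_ne _ h]
    have hdet : (mat a).det = 1 := a.2
    have h2 : mat a⁻¹ = (mat a)⁻¹ := by
      rw [Matrix.inv_def, hdet, Ring.inverse_one, one_smul]
      exact (Matrix.SpecialLinearGroup.coe_inv a).symm
    change mat a⁻¹ i j = 0
    rw [h2, hd, Matrix.inv_diagonal, Matrix.diagonal_apply_ne _ hij]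

/-- The flag variety `G/P_J`, with the quotient topology and the left action of `G`
(hence of `T`). -/
abbrev FlagVariety {r : ℕ} (J : Set (Fin r)) : Type := G r ⧸ parabolic J

/-- A representative of `w` in the normalizer of `T`: the matrix sending the basis vector `e_j` to
`e_{w j}`, up to the sign in the first column that makes the determinant `1`. -/
def weylLift {r : ℕ} (w : Weyl r) : G r :=
  ⟨Matrix.of fun i j => if i = w j then (if j = 0 then ((Equiv.Perm.sign w : ℤ) : ℂ) else 1) else 0,
   by
    have h : (Matrix.of fun i j => if i = w j then
          (if j = 0 then ((Equiv.Perm.sign w : ℤ) : ℂ) else 1) else 0) =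
        (Matrix.diagonal (fun j : Fin (r + 1) =>
          if j = 0 then ((Equiv.Perm.sign w : ℤ) : ℂ) else 1)).submatrix (w⁻¹ : Weyl r) id := by
      ext i j
      by_cases hij : i = w j
      · subst hij; simp
      · have : w⁻¹ i ≠ j := fun h => hij (by rw [← h]; simp)
        rw [Matrix.submatrix_apply, id, Matrix.diagonal_apply_ne _ this]
        simp [hij]
    rw [h, Matrix.det_permute, Matrix.det_diagonal, Finset.prod_ite_eq' Finset.univ (0 : Fin (r + 1))
      (fun _ => ((Equiv.Perm.sign w : ℤ) : ℂ))]
    rcases Int.units_eq_one_or (Equiv.Perm.sign w) with hs | hs <;> simp [hs]⟩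

/-- The `T`-fixed point `wP` of `G/P`. -/
def fixedPoint {r : ℕ} (J : Set (Fin r)) (w : Weyl r) : FlagVariety J :=
  (weylLift w : FlagVariety J)

/-- The Schubert variety `X_w`, the closure of the `B`-orbit of `wP` in `G/P`. -/
def schubert {r : ℕ} (J : Set (Fin r)) (w : Weyl r) : Set (FlagVariety J) :=
  closure (MulAction.orbit (borel r) (fixedPoint J w))

/-! ### Toric varieties in `G/P` and their fans -/

/-- A subvariety `X` of `G/P` is toric (for the action of `T`) if some `T`-orbit in `X` is open and
dense in `X`. -/
def IsToric {r : ℕ} {J : Set (Fin r)} (X : Set (FlagVariety J)) : Prop :=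
  ∃ x ∈ X, MulAction.orbit (torus r) x ⊆ X ∧ X ⊆ closure (MulAction.orbit (torus r) x) ∧
    ∃ U : Set (FlagVariety J), IsOpen U ∧ U ∩ X = MulAction.orbit (torus r) x

/-- A homomorphism `T → ℂˣ` is a character of the algebraic torus `T` if it is a Laurent monomial
in the diagonal entries. -/
def IsAlgebraicChar {r : ℕ} (χ : torus r →* ℂˣ) : Prop :=
  ∃ m : Fin (r + 1) → ℤ, ∀ t : torus r, (χ t : ℂ) = ∏ i, (mat t.1 i i) ^ m i

/-- The character lattice `M` of the torus `T / K` acting effectively on `X`, where `K` is the kernel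
of the action of `T` on `X`: the characters of `T` that are trivial on `K`.  The group law is written
multiplicatively. -/
def charLattice {r : ℕ} {J : Set (Fin r)} (X : Set (FlagVariety J)) : Subgroup (torus r →* ℂˣ) where
  carrier := {χ | IsAlgebraicChar χ ∧ ∀ t : torus r, (∀ x ∈ X, t • x = x) → χ t = 1}
  one_mem' := ⟨⟨0, by simp⟩, by simp⟩
  mul_mem' := by
    rintro a b ⟨⟨m, hm⟩, ha⟩ ⟨⟨k, hk⟩, hb⟩
    refine ⟨⟨m + k, fun t => ?_⟩, fun t ht => by simp [ha t ht, hb t ht]⟩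
    have h0 : ∀ i, mat t.1 i i ≠ 0 := by
      have hd : mat t.1 = Matrix.diagonal (fun i => mat t.1 i i) := by
        ext p q
        by_cases h : p = q
        · subst h; simp
        · rw [t.2 p q h, Matrix.diagonal_apply_ne _ h]
      have hdet : (mat t.1).det = 1 := t.1.2
      rw [hd, Matrix.det_diagonal] at hdet
      intro i hi
      exact zero_ne_one ((Finset.prod_eq_zero (f := fun i => mat t.1 i i) (Finset.mem_univ i) hi).symm.trans hdet)
    simp only [MonoidHom.mul_apply, Units.val_mul, hm, hk, ← Finset.prod_mul_distrib, Pi.add_apply]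
    exact Finset.prod_congr rfl fun i _ => (zpow_add₀ (h0 i) _ _).symm
  inv_mem' := by
    rintro a ⟨⟨m, hm⟩, ha⟩
    refine ⟨⟨-m, fun t => ?_⟩, fun t ht => by simp [ha t ht]⟩
    simp [hm]

/-- The real vector space `N_ℝ = Hom_ℤ(M, ℝ)` which contains the fan of `X`. -/
abbrev FanSpace {r : ℕ} {J : Set (Fin r)} (X : Set (FlagVariety J)) : Type :=
  Additive (charLattice X) →+ ℝ

/-- The map `N_ℝ → N'_ℝ` induced by an inclusion `M' ≤ M` of character lattices, by restriction;
for a `T`-equivariant surjection `X → X'` this is the linear map of fan spaces that it induces. -/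
def fanMap {r : ℕ} {J J' : Set (Fin r)} {X : Set (FlagVariety J)} {X' : Set (FlagVariety J')}
    (h : charLattice X' ≤ charLattice X) (ν : FanSpace X) : FanSpace X' :=
  ν.comp (MonoidHom.toAdditive (Subgroup.inclusion h))

/-- The `T`-stable neighbourhood in `X` of the orbit of `y`, made up of the points of `X` whose
`T`-orbit closure contains `y`.  In a normal toric variety it is the affine open subset `U_σ` in which
the orbit of `y` is the unique closed orbit. -/
def chart {r : ℕ} {J : Set (Fin r)} (X : Set (FlagVariety J)) (y : FlagVariety J) :
    Set (FlagVariety J) :=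
  {z ∈ X | y ∈ closure (MulAction.orbit (torus r) z)}

/-- Regular functions on a locally closed subset `U` of `G/P`: the pull-back of `f` to the preimage of
`U` in `G` is, Zariski locally, a quotient of two polynomials in the matrix entries. -/
def IsRegularOn {r : ℕ} {J : Set (Fin r)} (U : Set (FlagVariety J)) (f : FlagVariety J → ℂ) : Prop :=
  ∀ g : G r, (g : FlagVariety J) ∈ U →
    ∃ a b : MvPolynomial (Fin (r + 1) × Fin (r + 1)) ℂ,
      MvPolynomial.eval (fun p => mat g p.1 p.2) b ≠ 0 ∧
      ∀ h : G r, (h : FlagVariety J) ∈ U → MvPolynomial.eval (fun p => mat h p.1 p.2) b ≠ 0 →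
        f (h : FlagVariety J) =
          MvPolynomial.eval (fun p => mat h p.1 p.2) a / MvPolynomial.eval (fun p => mat h p.1 p.2) b

/-- The character `χ` is, up to a scalar, a regular function on the chart of `X` at `y`: there is a
nonzero regular function `f` on the chart with `f (t z) = χ(t) f(z)`. -/
def IsRegularChar {r : ℕ} {J : Set (Fin r)} (X : Set (FlagVariety J)) (y : FlagVariety J)
    (χ : torus r →* ℂˣ) : Prop :=
  ∃ f : FlagVariety J → ℂ, IsRegularOn (chart X y) f ∧ (∃ z ∈ chart X y, f z ≠ 0) ∧
    ∀ t : torus r, ∀ z ∈ chart X y, f (t • z) = (χ t : ℂ) * f z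

/-- The cone `σ` of the fan of the toric variety `X` that corresponds to the orbit of `y`.  Its affine
chart is `U_σ = Spec ℂ[σ^∨ ∩ M]`, so `σ ⊆ N_ℝ` is the dual of the cone of all characters in `M` that
are regular on the chart.  If `y` is a `T`-fixed point, `σ` is a maximal cone of the fan. -/
def orbitCone {r : ℕ} {J : Set (Fin r)} (X : Set (FlagVariety J)) (y : FlagVariety J) :
    Set (FanSpace X) :=
  {ν | ∀ χ : charLattice X, IsRegularChar X y χ → 0 ≤ ν (Additive.ofMul χ)}

end ToricSchubert

end

open Matrix Filter Topology

namespace ToricSchubert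

/-! ### Words in the simple reflections -/

/-! Let `w` be minimal in its coset. Over the open cell `BwP/P` the projection `X_w^B → X_w` has
one-point fibres: a point of `X_w^B` lies in the cell of a subword of a reduced word of `w`, and a
proper subword is too short to have its product in `wW_P` (`eq_mk_of_proj_eq`). Hence the dense
`T`-orbit of `X_w` lifts to one of `X_w^B`, its density because `X_w^B` is compact, its openness by
pulling back an open set. An element of `T` acts trivially on one variety if and only if it does so
on the other, since both contain the same cell densely; this gives equality of the lattices.

No structure theory of toric varieties is needed for the cones. If `u ∈ [v]`, then `uP = vP`, and a
semi-invariant regular function on the chart of `X_w` at `vP` pulls back to the chart of `X_w^B` at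
`uB`. Dually, `C_u^B ⊆ C_v` (`fanMap_mem_orbitCone`).

Conversely, let `ν ∈ C_v` (`exists_mem_lifts_mem_orbitCone`). Extend `ν` to a real vector `a` with
coordinate sum zero, and perturb it to `a + εc`, where `c` is `i ↦ v⁻¹ i` shifted to sum zero. For
small `ε > 0` the order of the coordinates is the fixed lexicographic order of the pairs `(aᵢ, cᵢ)`,
so Gaussian elimination in that order yields one `u` such that the one-parameter subgroup of `a +
εc` moves the generic point to `uB` (`exists_limit_fixedPoint`). Then `uB ∈ X_w^B`, so `u ≤ w`. A
character regular at `uB` stays bounded along this path, so it pairs non-negatively with `a + εc`,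
and in the limit `ε → 0` with `a`; thus `ν ∈ C_u^B`.

To see `uW_P = vW_P`, take `k ∉ J` and let `Δ_u`, `Δ_v` be the minors in the first columns up to `k`
with rows given by `u` and `v`. The quotient `Δ_u/Δ_v` is regular at `vP`, so its weight is
non-negative on `a`. Its inverse is regular at `uP`, so the same weight is non-positive on `a + εc`,
hence on `c`. But `c` is chosen such that the row set of `v` uniquely minimises this pairing
(`apply_le_of_sum_le`), so the row sets of `u` and `v` agree for all `k ∉ J`. -/

theorem wordProd_nil {r : ℕ} : wordProd ([] : List (Fin r)) = 1 := rfl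

theorem wordProd_cons {r : ℕ} (i : Fin r) (l : List (Fin r)) :
    wordProd (i :: l) = simpleReflection i * wordProd l := by
  simp [wordProd]

theorem wordProd_append {r : ℕ} (l l' : List (Fin r)) :
    wordProd (l ++ l') = wordProd l * wordProd l' := by
  simp [wordProd]

theorem wordProd_singleton {r : ℕ} (i : Fin r) : wordProd [i] = simpleReflection i := by
  simp [wordProd]

theorem simpleReflection_mul_self {r : ℕ} (i : Fin r) :
    simpleReflection i * simpleReflection i = 1 :=
  Equiv.swap_mul_self _ _

theorem simpleReflection_castSucc {r : ℕ} (i : Fin r) :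
    simpleReflection i i.castSucc = i.succ := Equiv.swap_apply_left _ _

theorem simpleReflection_succ {r : ℕ} (i : Fin r) :
    simpleReflection i i.succ = i.castSucc := Equiv.swap_apply_right _ _

/-- `s_j` reverses the order of no pair except `(j, j + 1)`. -/
theorem eq_of_simpleReflection_lt {r : ℕ} {j : Fin r} {x y : Fin (r + 1)} (hxy : x < y)
    (h : simpleReflection j y < simpleReflection j x) : x = j.castSucc ∧ y = j.succ := by
  have hx := Equiv.swap_apply_def j.castSucc j.succ x
  have hy := Equiv.swap_apply_def j.castSucc j.succ y
  simp only [simpleReflection, hx, hy] at h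
  split_ifs at h <;> simp only [Fin.lt_def, Fin.ext_iff, Fin.val_castSucc, Fin.val_succ] at * <;>
    omega

theorem simpleReflection_eq_of_conj {r : ℕ} {i j : Fin r} {u : Weyl r}
    (h1 : u i.castSucc = j.castSucc) (h2 : u i.succ = j.succ) :
    simpleReflection j * u * simpleReflection i = u := by
  have : u * simpleReflection i = simpleReflection j * u := by
    rw [simpleReflection, simpleReflection, Equiv.mul_swap_eq_swap_mul, h1, h2]
  rw [mul_assoc, this, ← mul_assoc, simpleReflection_mul_self, one_mul]

/-- The exchange property. -/
theorem exists_sublist_wordProd_mul {r : ℕ} (i : Fin r) :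
    ∀ l : List (Fin r), wordProd l i.succ < wordProd l i.castSucc →
      ∃ l' : List (Fin r), l'.Sublist l ∧ l'.length + 1 = l.length ∧
        wordProd l' = wordProd l * simpleReflection i
  | [], h => by
    simp only [wordProd_nil, Equiv.Perm.one_apply, Fin.lt_def, Fin.val_succ,
      Fin.val_castSucc] at h
    omega
  | j :: l, h => by
    have hne : wordProd l i.castSucc ≠ wordProd l i.succ := fun he => by
      have := (wordProd l).injective he
      simp [Fin.ext_iff] at this
    rcases lt_or_gt_of_ne hne with hlt | hgt
    · rw [wordProd_cons, Equiv.Perm.mul_apply, Equiv.Perm.mul_apply] at h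
      obtain ⟨h1, h2⟩ := eq_of_simpleReflection_lt hlt h
      exact ⟨l, List.sublist_cons_self j l, rfl, by
        rw [wordProd_cons, simpleReflection_eq_of_conj h1 h2]⟩
    · obtain ⟨l', hs, hl, hp⟩ := exists_sublist_wordProd_mul i l hgt
      exact ⟨j :: l', hs.cons_cons j, by simp [hl], by
        rw [wordProd_cons, wordProd_cons, hp, mul_assoc]⟩

theorem length_wordProd_le {r : ℕ} (l : List (Fin r)) : length (wordProd l) ≤ l.length :=
  Nat.sInf_le ⟨l, rfl, rfl⟩

theorem exists_wordProd_eq {r : ℕ} (w : Weyl r) : ∃ l : List (Fin r), wordProd l = w := by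
  have h : w ∈ Submonoid.closure (Set.range fun i : Fin r => Equiv.swap i.castSucc i.succ) := by
    rw [Equiv.Perm.mclosure_swap_castSucc_succ]; trivial
  obtain ⟨l, hl, hp⟩ := Submonoid.exists_list_of_mem_closure h
  clear h
  induction l generalizing w with
  | nil => exact ⟨[], hp⟩
  | cons x l ih =>
    obtain ⟨i, rfl⟩ := hl x (by simp)
    obtain ⟨l', hl'⟩ := ih _ (fun y hy => hl y (by simp [hy])) rfl
    exact ⟨i :: l', by rw [wordProd_cons, hl', ← hp, List.prod_cons]; rfl⟩

theorem exists_isReducedWord {r : ℕ} (w : Weyl r) : ∃ l : List (Fin r), IsReducedWord l w := by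
  obtain ⟨l, hl⟩ := exists_wordProd_eq w
  have hne : {m : ℕ | ∃ l : List (Fin r), l.length = m ∧ wordProd l = w}.Nonempty :=
    ⟨l.length, l, rfl, hl⟩
  obtain ⟨l', h1, h2⟩ := Nat.sInf_mem hne
  exact ⟨l', h2, h1⟩

theorem length_mul_simpleReflection_le {r : ℕ} (w : Weyl r) (i : Fin r) :
    length (w * simpleReflection i) ≤ length w + 1 := by
  obtain ⟨l, hl, hlen⟩ := exists_isReducedWord w
  have := length_wordProd_le (l ++ [i])
  rwa [wordProd_append, wordProd_singleton, hl, List.length_append, hlen] at this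

theorem length_mul_simpleReflection_of_gt {r : ℕ} {w : Weyl r} {i : Fin r}
    (h : w i.succ < w i.castSucc) : length (w * simpleReflection i) < length w := by
  obtain ⟨l, hl, hlen⟩ := exists_isReducedWord w
  obtain ⟨l', -, h1, h2⟩ := exists_sublist_wordProd_mul i l (by rwa [hl])
  have := length_wordProd_le l'
  rw [h2, hl] at this
  omega

theorem apply_castSucc_ne {r : ℕ} (w : Weyl r) (i : Fin r) :
    w i.castSucc ≠ w i.succ := fun he => by
  have := w.injective he
  simp [Fin.ext_iff] at this

theorem length_mul_simpleReflection_of_lt {r : ℕ} {w : Weyl r} {i : Fin r}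
    (h : w i.castSucc < w i.succ) : length w < length (w * simpleReflection i) := by
  have := length_mul_simpleReflection_of_gt (w := w * simpleReflection i) (i := i)
    (by simpa [simpleReflection_castSucc, simpleReflection_succ] using h)
  rwa [mul_assoc, simpleReflection_mul_self, mul_one] at this

/-- The deletion property: every word has a reduced subword with the same product. -/
theorem exists_sublist_isReducedWord {r : ℕ} (l : List (Fin r)) :
    ∃ l' : List (Fin r), l'.Sublist l ∧ IsReducedWord l' (wordProd l) := by
  induction l using List.reverseRecOn with
  | nil => exact ⟨[], List.Sublist.refl _, rfl, by
      exact (Nat.le_zero.mp (length_wordProd_le ([] : List (Fin r)))).symm⟩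
  | append_singleton l i ih =>
    obtain ⟨l', hs, hp, hl⟩ := ih
    rw [wordProd_append, wordProd_singleton]
    have hle := length_mul_simpleReflection_le (wordProd l) i
    rcases lt_or_gt_of_ne (apply_castSucc_ne (wordProd l) i) with h | h
    · have := length_mul_simpleReflection_of_lt h
      exact ⟨l' ++ [i], hs.append (List.Sublist.refl _), by
        rw [wordProd_append, wordProd_singleton, hp], by
        rw [List.length_append, hl]; simp only [List.length_singleton]; omega⟩
    · obtain ⟨l'', hs', h1, h2⟩ := exists_sublist_wordProd_mul i l' (by rwa [hp])
      rw [hp] at h2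
      refine ⟨l'', hs'.trans (hs.trans (List.sublist_append_left _ _)), h2, ?_⟩
      -- Multiplying back by `s_i` raises the length by at most one, so no word shorter than `l''`
      -- has this product.
      have h3 := length_wordProd_le l''
      have h4 := length_mul_simpleReflection_le (wordProd l * simpleReflection i) i
      rw [mul_assoc, simpleReflection_mul_self, mul_one] at h4
      rw [h2] at h3
      omega

theorem bruhatLE_of_sublist {r : ℕ} {w : Weyl r} {l l' : List (Fin r)} (hl : IsReducedWord l w)
    (hs : l'.Sublist l) : BruhatLE (wordProd l') w := by
  obtain ⟨l'', h1, h2⟩ := exists_sublist_isReducedWord l'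
  exact ⟨l, l'', hl, h1.trans hs, h2⟩

/-! ### Parabolic subgroups of the Weyl group -/

/-- `x` preserves the initial segments of indices ending in a `k ∉ J`. -/
def PreservesSteps {r : ℕ} (J : Set (Fin r)) (x : Weyl r) : Prop :=
  ∀ k ∉ J, ∀ j ≤ k.castSucc, x j ≤ k.castSucc

theorem preservesSteps_simpleReflection {r : ℕ} {J : Set (Fin r)} {i : Fin r} (hi : i ∈ J) :
    PreservesSteps J (simpleReflection i) := by
  intro k hk j hj
  have hne : i ≠ k := fun h => hk (h ▸ hi)
  have hx := Equiv.swap_apply_def i.castSucc i.succ j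
  rw [simpleReflection, hx]
  split_ifs <;> simp only [Fin.le_def, Fin.ext_iff, Fin.val_castSucc, Fin.val_succ, ne_eq] at * <;>
    omega

theorem preservesSteps_mul {r : ℕ} {J : Set (Fin r)} {x y : Weyl r} (hx : PreservesSteps J x)
    (hy : PreservesSteps J y) : PreservesSteps J (x * y) :=
  fun k hk j hj => hx k hk _ (hy k hk j hj)

/-- In a finite group the inverse is a positive power, so closure under products suffices. -/
theorem preservesSteps_inv {r : ℕ} {J : Set (Fin r)} {x : Weyl r} (hx : PreservesSteps J x) :
    PreservesSteps J x⁻¹ := by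
  intro k hk j hj
  have h : ∀ m : ℕ, PreservesSteps J (x ^ m) := by
    intro m
    induction m with
    | zero => exact fun k _ j hj => by simpa using hj
    | succ m ih => rw [pow_succ]; exact preservesSteps_mul ih hx
  have h2 : x⁻¹ = x ^ (orderOf x - 1) := by
    rw [inv_eq_iff_mul_eq_one, ← pow_succ', Nat.sub_add_cancel (orderOf_pos x), pow_orderOf_eq_one]
  rw [h2]
  exact h _ k hk j hj

theorem preservesSteps_of_mem {r : ℕ} {J : Set (Fin r)} {x : Weyl r}
    (hx : x ∈ weylParabolic J) : PreservesSteps J x := by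
  induction hx using Subgroup.closure_induction with
  | mem x hx =>
    obtain ⟨i, hi, rfl⟩ := hx
    exact preservesSteps_simpleReflection hi
  | one => exact fun k _ j hj => by simpa using hj
  | mul x y _ _ hx hy => exact preservesSteps_mul hx hy
  | inv x _ hx => exact preservesSteps_inv hx

theorem eq_one_of_forall_lt {r : ℕ} {x : Weyl r} (h : ∀ i : Fin r, x i.castSucc < x i.succ) :
    x = 1 := by
  have hm : StrictMono x := Fin.strictMono_iff_lt_succ.mpr h
  ext i
  have := congrArg (fun f : Fin (r + 1) ≃o Fin (r + 1) => f i)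
    (Subsingleton.elim (hm.orderIsoOfSurjective x x.surjective) (OrderIso.refl _))
  simpa using congrArg Fin.val this

/-- Induction on the length: a descent `i` of `x` must lie in `J`, since otherwise `x⁻¹`, which also
preserves the segment ending in `i`, would send `x (i + 1)` into it. Removing `s_i` shortens `x` and
keeps the hypothesis. -/
theorem mem_weylParabolic_of_preservesSteps {r : ℕ} {J : Set (Fin r)} :
    ∀ (m : ℕ) (x : Weyl r), length x = m → PreservesSteps J x → x ∈ weylParabolic J := by
  intro m
  induction m using Nat.strong_induction_on with
  | _ m ih =>
    intro x hm hx
    by_cases h : ∀ i : Fin r, x i.castSucc < x i.succ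
    · rw [eq_one_of_forall_lt h]; exact one_mem _
    · push Not at h
      obtain ⟨i, hi⟩ := h
      have hlt := lt_of_le_of_ne hi (apply_castSucc_ne x i).symm
      have hJ : i ∈ J := by
        by_contra hJ
        have h1 := hx i hJ i.castSucc le_rfl
        have h2 := preservesSteps_inv hx i hJ (x i.succ) (hlt.le.trans h1)
        simp [Fin.le_def] at h2
      have hs : simpleReflection i ∈ weylParabolic J :=
        Subgroup.subset_closure ⟨i, hJ, rfl⟩
      have h3 := ih _ (hm ▸ length_mul_simpleReflection_of_gt hlt) (x * simpleReflection i) rfl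
        (preservesSteps_mul hx (preservesSteps_simpleReflection hJ))
      simpa [mul_assoc, simpleReflection_mul_self] using mul_mem h3 hs

theorem mem_weylParabolic_iff {r : ℕ} {J : Set (Fin r)} {x : Weyl r} :
    x ∈ weylParabolic J ↔ PreservesSteps J x :=
  ⟨preservesSteps_of_mem, mem_weylParabolic_of_preservesSteps _ x rfl⟩

theorem weylParabolic_empty {r : ℕ} {x : Weyl r} (hx : x ∈ weylParabolic (∅ : Set (Fin r))) :
    x = 1 := by
  simpa [weylParabolic] using hx

theorem lt_of_mem_minCosetReps {r : ℕ} {J : Set (Fin r)} {w : Weyl r} (hw : w ∈ minCosetReps J)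
    {i : Fin r} (hi : i ∈ J) : w i.castSucc < w i.succ := by
  by_contra h
  have := length_mul_simpleReflection_of_gt
    (lt_of_le_of_ne (not_lt.mp h) (apply_castSucc_ne w i).symm)
  exact absurd (hw _ (Subgroup.subset_closure ⟨i, hi, rfl⟩)) (not_le.mpr this)

/-- A minimal coset representative is increasing on the blocks of `J`. -/
theorem lt_of_mem_minCosetReps_of_block {r : ℕ} {J : Set (Fin r)} {w : Weyl r}
    (hw : w ∈ minCosetReps J) {a b : Fin (r + 1)} (hab : a < b)
    (hJ : ∀ k : Fin r, a ≤ k.castSucc → k.castSucc < b → k ∈ J) : w a < w b := by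
  induction b using Fin.induction with
  | zero => exact absurd hab (Fin.not_lt_zero a)
  | succ i ih =>
    have hai : a ≤ i.castSucc := by
      simp only [Fin.lt_def, Fin.le_def, Fin.val_succ, Fin.val_castSucc] at *; omega
    have hi : w i.castSucc < w i.succ :=
      lt_of_mem_minCosetReps hw (hJ i hai (by simp [Fin.lt_def]))
    rcases hai.lt_or_eq with h | h
    · exact (ih h fun k h1 h2 => hJ k h1 (h2.trans (by simp [Fin.lt_def]))).trans hi
    · rwa [h]

/-! ### Monomial matrices and Bruhat cells -/

theorem weyl_apply_inv {r : ℕ} (u : Weyl r) (i : Fin (r + 1)) : u (u⁻¹ i) = i :=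
  Equiv.apply_symm_apply u i

theorem weyl_inv_apply {r : ℕ} (u : Weyl r) (i : Fin (r + 1)) : u⁻¹ (u i) = i :=
  Equiv.symm_apply_apply u i

theorem mat_mul_apply {r : ℕ} (a b : G r) (i j : Fin (r + 1)) :
    mat (a * b) i j = ∑ k, mat a i k * mat b k j := by
  change (mat a * mat b) i j = _
  rw [Matrix.mul_apply]

theorem mem_borel_iff {r : ℕ} {g : G r} : g ∈ borel r ↔ ∀ i j, j < i → mat g i j = 0 := by
  constructor
  · intro h i j hji
    have hj : (j : ℕ) < r := by
      have := i.2; simp only [Fin.lt_def] at hji; omega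
    exact h ⟨j, hj⟩ (by simp) i j le_rfl hji
  · intro h k _ i j hj hi
    exact h i j (hj.trans_lt hi)

theorem borel_le_parabolic {r : ℕ} (J : Set (Fin r)) : borel r ≤ parabolic J :=
  fun _ hg k _ => hg k (by simp)

theorem apply_self_ne_zero_of_mem_borel {r : ℕ} {b : G r} (hb : b ∈ borel r) (i : Fin (r + 1)) :
    mat b i i ≠ 0 := by
  intro h
  have hdet : (mat b).det = 1 := b.2
  rw [Matrix.det_of_isUpperTriangular (fun i j hij => mem_borel_iff.mp hb i j hij)] at hdet
  exact zero_ne_one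
    ((Finset.prod_eq_zero (f := fun i => mat b i i) (Finset.mem_univ i) h).symm.trans hdet)

/-- The monomial matrices of shape `u`: the coset of the torus in its normalizer given by `u`. -/
def monomial {r : ℕ} (u : Weyl r) : Set (G r) := {g | ∀ i j, i ≠ u j → mat g i j = 0}

theorem weylLift_mem_monomial {r : ℕ} (u : Weyl r) : weylLift u ∈ monomial u := by
  intro i j hij
  exact if_neg hij

theorem mem_monomial_one_iff {r : ℕ} {g : G r} : g ∈ monomial 1 ↔ g ∈ torus r := Iff.rfl

theorem mul_monomial_apply {r : ℕ} {u : Weyl r} {n : G r} (hn : n ∈ monomial u) (g : G r)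
    (i j : Fin (r + 1)) : mat (g * n) i j = mat g i (u j) * mat n (u j) j := by
  rw [mat_mul_apply]
  exact Finset.sum_eq_single _ (fun k _ hk => by rw [hn k j hk, mul_zero]) (by simp)

theorem monomial_mul_apply {r : ℕ} {u : Weyl r} {n : G r} (hn : n ∈ monomial u) (g : G r)
    (i j : Fin (r + 1)) : mat (n * g) (u i) j = mat n (u i) i * mat g i j := by
  rw [mat_mul_apply]
  exact Finset.sum_eq_single _
    (fun k _ hk => by rw [hn _ k fun h => hk (u.injective h).symm, zero_mul]) (by simp)

theorem monomial_apply_ne_zero {r : ℕ} {u : Weyl r} {n : G r} (hn : n ∈ monomial u)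
    (j : Fin (r + 1)) : mat n (u j) j ≠ 0 := by
  intro h
  have h1 := mul_monomial_apply hn n⁻¹ j j
  rw [h, mul_zero, inv_mul_cancel] at h1
  simp at h1

theorem mul_mem_monomial {r : ℕ} {u v : Weyl r} {m n : G r} (hm : m ∈ monomial u)
    (hn : n ∈ monomial v) : m * n ∈ monomial (u * v) := by
  intro i j hij
  rw [mul_monomial_apply hn, hm _ _ hij, zero_mul]

theorem inv_mem_monomial {r : ℕ} {u : Weyl r} {n : G r} (hn : n ∈ monomial u) :
    n⁻¹ ∈ monomial u⁻¹ := by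
  intro i k hik
  have h1 := mul_monomial_apply hn n⁻¹ i (u⁻¹ k)
  rw [inv_mul_cancel, weyl_apply_inv] at h1
  have h2 := monomial_apply_ne_zero hn (u⁻¹ k)
  rw [weyl_apply_inv] at h2
  have h3 : mat (1 : G r) i (u⁻¹ k) = 0 := Matrix.one_apply_ne hik
  rw [h3] at h1
  exact (mul_eq_zero.mp h1.symm).resolve_right h2

theorem conj_monomial_apply {r : ℕ} {u : Weyl r} {n : G r} (hn : n ∈ monomial u) (g : G r)
    (i j : Fin (r + 1)) :
    mat (n⁻¹ * g * n) i j = mat n⁻¹ i (u i) * mat g (u i) (u j) * mat n (u j) j := by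
  have h := monomial_mul_apply (inv_mem_monomial hn) g (u i) (u j)
  rw [weyl_inv_apply] at h
  rw [mul_monomial_apply hn, h]

theorem torus_le_borel (r : ℕ) : torus r ≤ borel r :=
  fun _ ht => mem_borel_iff.mpr fun i j hji => ht i j hji.ne'

theorem monomial_subset_parabolic {r : ℕ} {J : Set (Fin r)} {u : Weyl r}
    (hu : u ∈ weylParabolic J) : monomial u ⊆ (parabolic J : Set (G r)) := by
  intro n hn k hk i j hj hi
  exact hn i j fun h => absurd (h ▸ preservesSteps_of_mem hu k hk j hj) (not_le.mpr hi)

/-- The double coset `B u B`. -/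
def cell {r : ℕ} (u : Weyl r) : Set (G r) :=
  {g | ∃ b ∈ borel r, ∃ n ∈ monomial u, ∃ b' ∈ borel r, g = b * n * b'}

theorem monomial_subset_cell {r : ℕ} (u : Weyl r) : monomial u ⊆ cell u :=
  fun n hn => ⟨1, one_mem _, n, hn, 1, one_mem _, by simp⟩

theorem mul_mem_cell {r : ℕ} {u : Weyl r} {b g : G r} (hb : b ∈ borel r) (hg : g ∈ cell u) :
    b * g ∈ cell u := by
  obtain ⟨b1, h1, n, hn, b2, h2, rfl⟩ := hg
  exact ⟨b * b1, mul_mem hb h1, n, hn, b2, h2, by simp only [mul_assoc]⟩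

theorem mem_cell_mul {r : ℕ} {u : Weyl r} {b g : G r} (hg : g ∈ cell u) (hb : b ∈ borel r) :
    g * b ∈ cell u := by
  obtain ⟨b1, h1, n, hn, b2, h2, rfl⟩ := hg
  exact ⟨b1, h1, n, hn, b2 * b, mul_mem h2 hb, by simp only [mul_assoc]⟩

/-- Disjointness of the Bruhat cells of `G/P`. -/
theorem mk_eq_mk_of_cell {r : ℕ} {J : Set (Fin r)} {u w : Weyl r} {g h : G r} (hg : g ∈ cell u)
    (hh : h ∈ cell w) (he : (g : FlagVariety J) = (h : FlagVariety J)) :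
    (u : Weyl r ⧸ weylParabolic J) = (w : Weyl r ⧸ weylParabolic J) := by
  obtain ⟨b1, h1, n, hn, b2, h2, rfl⟩ := hg
  obtain ⟨b3, h3, m, hm, b4, h4, rfl⟩ := hh
  rw [QuotientGroup.eq] at he
  have hp : b2 * ((b1 * n * b2)⁻¹ * (b3 * m * b4)) * b4⁻¹ ∈ parabolic J :=
    mul_mem (mul_mem (borel_le_parabolic J h2) he) (inv_mem (borel_le_parabolic J h4))
  have hb : b3⁻¹ * b1 ∈ borel r := mul_mem (inv_mem h3) h1
  set p := b2 * ((b1 * n * b2)⁻¹ * (b3 * m * b4)) * b4⁻¹ with hpdef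
  set b := b3⁻¹ * b1 with hbdef
  have hbp : m * p⁻¹ = b * n := by rw [hpdef, hbdef]; group
  symm
  rw [QuotientGroup.eq, mem_weylParabolic_iff]
  intro k hk j hj
  by_contra hlt
  rw [not_le] at hlt
  -- Compare the entries of `m * p⁻¹ = b * n` at `(u j, j)`: the right side is a product of nonzero
  -- entries, while on the left `p⁻¹` contributes an entry in the block that vanishes on `P`.
  have e1 := mul_monomial_apply hn b (u j) j
  have e2 := monomial_mul_apply hm p⁻¹ ((w⁻¹ * u) j) j
  have e3 : w ((w⁻¹ * u) j) = u j := by simp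
  rw [e3, (inv_mem hp) k hk _ j hj hlt, mul_zero, hbp, e1] at e2
  exact mul_ne_zero (apply_self_ne_zero_of_mem_borel hb _) (monomial_apply_ne_zero hn j) e2

theorem mk_monomial_eq {r : ℕ} {J : Set (Fin r)} {u v : Weyl r} {n m : G r}
    (hn : n ∈ monomial u) (hm : m ∈ monomial v)
    (h : (u : Weyl r ⧸ weylParabolic J) = (v : Weyl r ⧸ weylParabolic J)) :
    (n : FlagVariety J) = (m : FlagVariety J) := by
  rw [QuotientGroup.eq] at h ⊢
  exact monomial_subset_parabolic h (mul_mem_monomial (inv_mem_monomial hn) hm)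

/-- For a minimal coset representative `w` the projection from `BwB/B` to `BwP/P` is injective. -/
theorem mk_borel_eq_of_mk_eq {r : ℕ} {J : Set (Fin r)} {w : Weyl r} (hw : w ∈ minCosetReps J)
    {g h : G r} (hg : g ∈ cell w) (hh : h ∈ cell w)
    (he : (g : FlagVariety J) = (h : FlagVariety J)) :
    (g : FlagVariety (∅ : Set (Fin r))) = (h : FlagVariety (∅ : Set (Fin r))) := by
  obtain ⟨b1, h1, n, hn, b2, h2, rfl⟩ := hg
  obtain ⟨b3, h3, m, hm, b4, h4, rfl⟩ := hh
  rw [QuotientGroup.eq] at he ⊢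
  -- Both `m` and `n` have shape `w`, so they differ by a diagonal matrix, which `b` absorbs.
  have hb : b1⁻¹ * b3 * (m * n⁻¹) ∈ borel r := by
    refine mul_mem (mul_mem (inv_mem h1) h3) (torus_le_borel r ?_)
    rw [← mem_monomial_one_iff]
    simpa using mul_mem_monomial hm (inv_mem_monomial hn)
  set b := b1⁻¹ * b3 * (m * n⁻¹) with hbdef
  have e : (b1 * n * b2)⁻¹ * (b3 * m * b4) = b2⁻¹ * (n⁻¹ * b * n) * b4 := by
    rw [hbdef]; group
  rw [e] at he ⊢
  have hp : n⁻¹ * b * n ∈ parabolic J := by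
    have := mul_mem (mul_mem (borel_le_parabolic J h2) he) (inv_mem (borel_le_parabolic J h4))
    convert this using 1
    group
  refine mul_mem (mul_mem (inv_mem h2) (mem_borel_iff.mpr fun i j hji => ?_)) h4
  -- Inside a block of `J` the map `w` is increasing, so the entry comes from below the diagonal of
  -- `b`; across blocks the entry vanishes by membership in `P`.
  by_cases hJ : ∀ k : Fin r, j ≤ k.castSucc → k.castSucc < i → k ∈ J
  · rw [conj_monomial_apply hn,
      mem_borel_iff.mp hb _ _ (lt_of_mem_minCosetReps_of_block hw hji hJ), mul_zero, zero_mul]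
  · push Not at hJ
    obtain ⟨k, hk1, hk2, hk⟩ := hJ
    exact hp k hk i j hk1 hk2

/-! ### Root subgroups and minimal parabolics -/

/-- The elements `1 + c E_{i,j}` of `G`. -/
def rootElt {r : ℕ} {i j : Fin (r + 1)} (h : i ≠ j) (c : ℂ) : G r :=
  ⟨transvection i j c, det_transvection_of_ne i j h c⟩

theorem mat_rootElt {r : ℕ} {i j : Fin (r + 1)} (h : i ≠ j) (c : ℂ) :
    mat (rootElt h c) = transvection i j c := rfl

theorem rootElt_zero {r : ℕ} {i j : Fin (r + 1)} (h : i ≠ j) : rootElt h 0 = (1 : G r) := by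
  apply Subtype.ext
  change transvection i j (0 : ℂ) = 1
  simp

theorem rootElt_mul {r : ℕ} {i j : Fin (r + 1)} (h : i ≠ j) (c d : ℂ) :
    rootElt h c * rootElt h d = (rootElt h (c + d) : G r) :=
  Subtype.ext (transvection_mul_transvection_same i j h c d)

theorem rootElt_inv {r : ℕ} {i j : Fin (r + 1)} (h : i ≠ j) (c : ℂ) :
    (rootElt h c)⁻¹ = (rootElt h (-c) : G r) := by
  rw [inv_eq_iff_mul_eq_one, rootElt_mul, add_neg_cancel, rootElt_zero]

theorem rootElt_apply_eq_zero {r : ℕ} {i j a b : Fin (r + 1)} (h : i ≠ j) (c : ℂ) (hab : a ≠ b)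
    (hne : ¬ (a = i ∧ b = j)) : mat (rootElt h c : G r) a b = 0 := by
  rw [mat_rootElt, transvection, Matrix.add_apply, Matrix.one_apply_ne hab, zero_add,
    Matrix.single_apply_of_ne]
  rintro ⟨rfl, rfl⟩
  exact hne ⟨rfl, rfl⟩

theorem conj_rootElt_mem_borel {r : ℕ} {u : Weyl r} {n : G r} (hn : n ∈ monomial u)
    {i j : Fin (r + 1)} (h : i ≠ j) (hu : u⁻¹ i < u⁻¹ j) (c : ℂ) :
    n⁻¹ * rootElt h c * n ∈ borel r := by
  refine mem_borel_iff.mpr fun a b hba => ?_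
  rw [conj_monomial_apply hn, rootElt_apply_eq_zero h c (fun he => hba.ne' (u.injective he)),
    mul_zero, zero_mul]
  rintro ⟨rfl, rfl⟩
  simp only [weyl_inv_apply] at hu
  exact lt_asymm hba hu

theorem mat_mul_rootElt_apply_same {r : ℕ} {i j : Fin (r + 1)} (h : i ≠ j) (c : ℂ) (g : G r)
    (a : Fin (r + 1)) : mat (g * rootElt h c) a j = mat g a j + c * mat g a i :=
  mul_transvection_apply_same i j a c (mat g)

theorem castSucc_ne_succ {r : ℕ} (i : Fin r) : i.castSucc ≠ i.succ := by
  simp [Fin.ext_iff]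

/-- The positive simple root elements. -/
abbrev upperElt {r : ℕ} (i : Fin r) (c : ℂ) : G r := rootElt (castSucc_ne_succ i) c

/-- The negative simple root elements. -/
abbrev lowerElt {r : ℕ} (i : Fin r) (c : ℂ) : G r := rootElt (castSucc_ne_succ i).symm c

theorem mem_minParabolic_iff {r : ℕ} {i : Fin r} {p : G r} :
    p ∈ parabolic ({i} : Set (Fin r)) ↔
      ∀ a b, b < a → ¬ (a = i.succ ∧ b = i.castSucc) → mat p a b = 0 := by
  constructor
  · intro hp a b hba hne
    by_cases h : b = i.castSucc
    · have ha : i.succ < a := by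
        refine lt_of_le_of_ne ?_ fun h' => hne ⟨h'.symm, h⟩
        rw [h] at hba
        simpa [Fin.le_def, Fin.lt_def, Nat.succ_le_iff] using hba
      have hi : (i : ℕ) + 1 < r := by
        have := a.2; simp only [Fin.lt_def, Fin.val_succ] at ha; omega
      exact hp ⟨i + 1, hi⟩ (by simp [Fin.ext_iff]) a b (by simp [h, Fin.le_def])
        (by simpa [Fin.lt_def] using ha)
    · have hb : (b : ℕ) < r := by
        have := a.2; simp only [Fin.lt_def] at hba; omega
      exact hp ⟨b, hb⟩ (by simpa [Fin.ext_iff] using h) a b le_rfl hba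
  · intro h k hk a b hb ha
    refine h a b (hb.trans_lt ha) ?_
    rintro ⟨rfl, rfl⟩
    refine hk ?_
    simp only [Fin.le_def, Fin.lt_def, Fin.val_succ, Fin.val_castSucc] at *
    simp only [Set.mem_singleton_iff, Fin.ext_iff]
    omega

theorem mem_borel_of_mem_minParabolic {r : ℕ} {i : Fin r} {p : G r}
    (hp : p ∈ parabolic ({i} : Set (Fin r))) (h : mat p i.succ i.castSucc = 0) : p ∈ borel r := by
  refine mem_borel_iff.mpr fun a b hba => ?_
  by_cases hab : a = i.succ ∧ b = i.castSucc
  · rw [hab.1, hab.2, h]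
  · exact mem_minParabolic_iff.mp hp a b hba hab

theorem minParabolic_row_ne_zero {r : ℕ} {i : Fin r} {p : G r}
    (hp : p ∈ parabolic ({i} : Set (Fin r))) :
    mat p i.succ i.castSucc ≠ 0 ∨ mat p i.succ i.succ ≠ 0 := by
  by_cases h : mat p i.succ i.castSucc = 0
  · exact Or.inr (apply_self_ne_zero_of_mem_borel (mem_borel_of_mem_minParabolic hp h) _)
  · exact Or.inl h

theorem lowerElt_mem {r : ℕ} (i : Fin r) (c : ℂ) :
    lowerElt i c ∈ parabolic ({i} : Set (Fin r)) :=
  mem_minParabolic_iff.mpr fun _ _ hba hne => rootElt_apply_eq_zero _ c hba.ne' hne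

theorem upperElt_mem_borel {r : ℕ} (i : Fin r) (c : ℂ) : upperElt i c ∈ borel r :=
  mem_borel_iff.mpr fun a b hba => rootElt_apply_eq_zero _ c hba.ne' (by
    rintro ⟨rfl, rfl⟩
    simp only [Fin.lt_def, Fin.val_succ, Fin.val_castSucc] at hba
    omega)

theorem monomial_simpleReflection_subset {r : ℕ} (i : Fin r) :
    monomial (simpleReflection i) ⊆ (parabolic ({i} : Set (Fin r)) : Set (G r)) :=
  monomial_subset_parabolic (Subgroup.subset_closure ⟨i, rfl, rfl⟩)

theorem exists_borel_mul_lowerElt {r : ℕ} {i : Fin r} {p : G r}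
    (hp : p ∈ parabolic ({i} : Set (Fin r))) (h : mat p i.succ i.succ ≠ 0) :
    ∃ b ∈ borel r, p = b * lowerElt i (mat p i.succ i.castSucc / mat p i.succ i.succ) := by
  set c := mat p i.succ i.castSucc / mat p i.succ i.succ with hc
  refine ⟨p * lowerElt i (-c), mem_borel_of_mem_minParabolic (mul_mem hp (lowerElt_mem i _)) ?_, ?_⟩
  · rw [mat_mul_rootElt_apply_same, hc]
    field_simp
    ring
  · rw [mul_assoc, rootElt_mul, neg_add_cancel, rootElt_zero, mul_one]

theorem exists_borel_mul_upperElt {r : ℕ} {i : Fin r} {p n : G r}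
    (hp : p ∈ parabolic ({i} : Set (Fin r))) (hn : n ∈ monomial (simpleReflection i))
    (h : mat p i.succ i.castSucc ≠ 0) :
    ∃ b ∈ borel r,
      p = b * n⁻¹ * upperElt i (mat p i.succ i.succ / mat p i.succ i.castSucc) := by
  set c := mat p i.succ i.succ / mat p i.succ i.castSucc with hc
  refine ⟨p * upperElt i (-c) * n, mem_borel_of_mem_minParabolic (mul_mem (mul_mem hp
    (borel_le_parabolic _ (upperElt_mem_borel i _))) (monomial_simpleReflection_subset i hn)) ?_, ?_⟩
  · rw [mul_monomial_apply hn, simpleReflection_castSucc, mat_mul_rootElt_apply_same, hc]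
    field_simp
    ring
  · rw [mul_inv_cancel_right, mul_assoc, rootElt_mul, neg_add_cancel, rootElt_zero, mul_one]

/-- `P_i B u B ⊆ B u B ∪ B s_i u B`. -/
theorem minParabolic_mul_mem_cell {r : ℕ} {i : Fin r} {u : Weyl r} {p g : G r}
    (hp : p ∈ parabolic ({i} : Set (Fin r))) (hg : g ∈ cell u) :
    p * g ∈ cell u ∨ p * g ∈ cell (simpleReflection i * u) := by
  obtain ⟨b1, h1, n, hn, b2, h2, rfl⟩ := hg
  have hp' : p * b1 ∈ parabolic ({i} : Set (Fin r)) := mul_mem hp (borel_le_parabolic _ h1)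
  set q := p * b1 with hq
  have hs := weylLift_mem_monomial (simpleReflection i)
  set s := weylLift (simpleReflection i)
  have hsn : s⁻¹ * n ∈ monomial (simpleReflection i * u) := by
    have h := mul_mem_monomial (inv_mem_monomial hs) hn
    rwa [inv_eq_of_mul_eq_one_left (simpleReflection_mul_self i)] at h
  rw [show p * (b1 * n * b2) = q * n * b2 by rw [hq]; group]
  have hne : u⁻¹ i.castSucc ≠ u⁻¹ i.succ := apply_castSucc_ne _ i
  by_cases hc : mat q i.succ i.castSucc = 0
  · exact Or.inl ⟨q, mem_borel_of_mem_minParabolic hp' hc, n, hn, b2, h2, rfl⟩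
  by_cases hd : mat q i.succ i.succ = 0
  · obtain ⟨b, hb, e⟩ := exists_borel_mul_upperElt hp' hs hc
    rw [hd, zero_div, upperElt, rootElt_zero, mul_one] at e
    exact Or.inr ⟨b, hb, s⁻¹ * n, hsn, b2, h2, by rw [e]; group⟩
  -- Now both factorisations of `q` exist; use the one whose root element `n` conjugates into `B`.
  rcases lt_or_gt_of_ne hne with h | h
  · obtain ⟨b, hb, e⟩ := exists_borel_mul_upperElt hp' hs hc
    refine Or.inr ⟨b, hb, s⁻¹ * n, hsn, _, mul_mem (conj_rootElt_mem_borel hn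
      (castSucc_ne_succ i) h (mat q i.succ i.succ / mat q i.succ i.castSucc)) h2, ?_⟩
    nth_rewrite 1 [e]
    group
  · obtain ⟨b, hb, e⟩ := exists_borel_mul_lowerElt hp' hd
    refine Or.inl ⟨b, hb, n, hn, _, mul_mem (conj_rootElt_mem_borel hn
      (castSucc_ne_succ i).symm h (mat q i.succ i.castSucc / mat q i.succ i.succ)) h2, ?_⟩
    nth_rewrite 1 [e]
    group

/-! ### Topology of the flag varieties -/

theorem continuous_mat_apply {r : ℕ} (i j : Fin (r + 1)) : Continuous fun g : G r => mat g i j :=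
  continuous_subtype_val.matrix_elem i j

/-- Supplies the separation of `G/P` by which compact subsets are closed. -/
instance isClosed_parabolic {r : ℕ} (J : Set (Fin r)) : IsClosed (parabolic J : Set (G r)) := by
  have h : (parabolic J : Set (G r)) =
      ⋂ k ∉ J, ⋂ i, ⋂ j, {g : G r | j ≤ k.castSucc → k.castSucc < i → mat g i j = 0} := by
    ext g
    simp only [Set.mem_iInter]
    rfl
  rw [h]
  refine isClosed_iInter fun k => isClosed_iInter fun _ => isClosed_iInter fun i =>
    isClosed_iInter fun j => ?_
  by_cases h1 : j ≤ k.castSucc <;> by_cases h2 : k.castSucc < i <;>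
    simp only [h1, h2, true_imp_iff, false_imp_iff, Set.ofPred_true, isClosed_univ]
  exact isClosed_eq (continuous_mat_apply i j) continuous_const

theorem continuous_rootElt {r : ℕ} {i j : Fin (r + 1)} (h : i ≠ j) :
    Continuous fun c : ℂ => (rootElt h c : G r) := by
  refine Continuous.subtype_mk (continuous_matrix fun a b => ?_) _
  simp only [transvection, Matrix.add_apply, Matrix.single_apply]
  split_ifs <;> fun_prop

/-- The projection `G/B → G/P`. -/
def proj {r : ℕ} (J : Set (Fin r)) : FlagVariety (∅ : Set (Fin r)) → FlagVariety J :=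
  Subgroup.quotientMapOfLE (borel_le_parabolic J)

theorem continuous_proj {r : ℕ} (J : Set (Fin r)) : Continuous (proj J) :=
  (QuotientGroup.isOpenQuotientMap_mk).continuous_comp_iff.mp QuotientGroup.continuous_mk

theorem smul_mk {r : ℕ} {J : Set (Fin r)} (t : torus r) (g : G r) :
    t • (g : FlagVariety J) = ((t.1 * g : G r) : FlagVariety J) := rfl

theorem proj_smul {r : ℕ} (J : Set (Fin r)) (t : torus r) (x : FlagVariety (∅ : Set (Fin r))) :
    proj J (t • x) = t • proj J x := by
  induction x using QuotientGroup.induction_on with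
  | _ g => rfl

theorem continuous_torus_smul {r : ℕ} {J : Set (Fin r)} (t : torus r) :
    Continuous fun x : FlagVariety J => t • x :=
  continuous_const_smul (t : G r)

theorem orbit_fixedPoint {r : ℕ} (J : Set (Fin r)) (w : Weyl r) :
    MulAction.orbit (borel r) (fixedPoint J w) = (fun g : G r => (g : FlagVariety J)) '' cell w := by
  ext x
  constructor
  · rintro ⟨b, rfl⟩
    exact ⟨b.1 * weylLift w, mul_mem_cell b.2 (monomial_subset_cell w (weylLift_mem_monomial w)), rfl⟩
  · rintro ⟨_, ⟨b, hb, n, hn, b', hb', rfl⟩, rfl⟩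
    refine ⟨⟨b, hb⟩, ?_⟩
    have h1 : ((b * n * b' : G r) : FlagVariety J) = ((b * n : G r) : FlagVariety J) :=
      QuotientGroup.mk_mul_of_mem _ (borel_le_parabolic J hb')
    have h2 : (n : FlagVariety J) = fixedPoint J w :=
      mk_monomial_eq hn (weylLift_mem_monomial w) rfl
    change b • fixedPoint J w = ((b * n * b' : G r) : FlagVariety J)
    rw [h1, ← h2]
    rfl

theorem schubert_eq {r : ℕ} (J : Set (Fin r)) (w : Weyl r) :
    schubert J w = closure ((fun g : G r => (g : FlagVariety J)) '' cell w) := by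
  rw [schubert, orbit_fixedPoint]

theorem mk_mem_schubert_of_mem_closure {r : ℕ} (J : Set (Fin r)) {w : Weyl r} {g : G r}
    (hg : g ∈ closure (cell w)) : (g : FlagVariety J) ∈ schubert J w := by
  rw [schubert_eq]
  exact map_mem_closure QuotientGroup.continuous_mk hg fun x hx => ⟨x, hx, rfl⟩

theorem proj_mem_schubert {r : ℕ} (J : Set (Fin r)) {w : Weyl r}
    {x : FlagVariety (∅ : Set (Fin r))} (hx : x ∈ schubert ∅ w) : proj J x ∈ schubert J w := by
  rw [schubert_eq] at hx ⊢
  refine map_mem_closure (continuous_proj J) hx ?_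
  rintro _ ⟨g, hg, rfl⟩
  exact ⟨g, hg, rfl⟩

theorem smul_mem_schubert {r : ℕ} {J : Set (Fin r)} {w : Weyl r} (t : torus r)
    {x : FlagVariety J} (hx : x ∈ schubert J w) : t • x ∈ schubert J w := by
  rw [schubert_eq] at hx ⊢
  refine map_mem_closure (continuous_torus_smul t) hx ?_
  rintro _ ⟨g, hg, rfl⟩
  exact ⟨t.1 * g, mul_mem_cell (torus_le_borel r t.2) hg, rfl⟩

/-! ### Products of minimal parabolics -/

/-- The set `P_{i_1} ⋯ P_{i_m} B`. -/
def parabolicProd {r : ℕ} : List (Fin r) → Set (G r)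
  | [] => (borel r : Set (G r))
  | i :: l => {g | ∃ p ∈ parabolic ({i} : Set (Fin r)), ∃ z ∈ parabolicProd l, g = p * z}

/-- A compact set of representatives for `P_i / B`. -/
def minParabolicReps {r : ℕ} (i : Fin r) : Set (G r) :=
  (fun c => lowerElt i c) '' Metric.closedBall 0 1 ∪
    (fun c => upperElt i c * weylLift (simpleReflection i)) '' Metric.closedBall 0 1

/-- A compact set of representatives for `P_{i_1} ⋯ P_{i_m} B / B`. -/
def parabolicProdReps {r : ℕ} : List (Fin r) → Set (G r)
  | [] => {1}
  | i :: l => Set.image2 (· * ·) (minParabolicReps i) (parabolicProdReps l)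

theorem isCompact_minParabolicReps {r : ℕ} (i : Fin r) : IsCompact (minParabolicReps i) :=
  ((isCompact_closedBall _ _).image (continuous_rootElt _)).union
    ((isCompact_closedBall _ _).image ((continuous_rootElt _).mul continuous_const))

theorem isCompact_parabolicProdReps {r : ℕ} (l : List (Fin r)) :
    IsCompact (parabolicProdReps l) := by
  induction l with
  | nil => exact isCompact_singleton
  | cons i l ih =>
    rw [parabolicProdReps, ← Set.image_prod]
    exact ((isCompact_minParabolicReps i).prod ih).image continuous_mul

/-- The quotient `P_i/B` is a projective line, covered by two closed unit discs: dividing by the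
larger of the two entries in the relevant row gives a coordinate of norm at most one. -/
theorem exists_reps_mul_borel {r : ℕ} {i : Fin r} {p : G r}
    (hp : p ∈ parabolic ({i} : Set (Fin r))) :
    ∃ k ∈ minParabolicReps i, ∃ b ∈ borel r, p = k * b := by
  -- The available factorisations have `B` on the left; inverting moves it to the right.
  have hq := inv_mem hp
  set q := p⁻¹ with hqdef
  have hpq : p = q⁻¹ := by rw [hqdef, inv_inv]
  have hs := weylLift_mem_monomial (simpleReflection i)
  by_cases h : ‖mat q i.succ i.castSucc‖ ≤ ‖mat q i.succ i.succ‖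
  · have h0 : mat q i.succ i.succ ≠ 0 := by
      rcases minParabolic_row_ne_zero hq with h1 | h1
      · exact norm_pos_iff.mp ((norm_pos_iff.mpr h1).trans_le h)
      · exact h1
    obtain ⟨b, hb, e⟩ := exists_borel_mul_lowerElt hq h0
    refine ⟨_, Or.inl ⟨-(mat q i.succ i.castSucc / mat q i.succ i.succ), ?_, rfl⟩, b⁻¹,
      inv_mem hb, ?_⟩
    · rw [mem_closedBall_zero_iff, norm_neg, norm_div]
      exact div_le_one_of_le₀ h (norm_nonneg _)
    · rw [hpq]
      nth_rewrite 1 [e]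
      rw [_root_.mul_inv_rev, lowerElt, rootElt_inv]
  · have h' := (not_le.mp h)
    have h0 : mat q i.succ i.castSucc ≠ 0 := norm_pos_iff.mp ((norm_nonneg _).trans_lt h')
    obtain ⟨b, hb, e⟩ := exists_borel_mul_upperElt hq hs h0
    refine ⟨_, Or.inr ⟨-(mat q i.succ i.succ / mat q i.succ i.castSucc), ?_, rfl⟩, b⁻¹,
      inv_mem hb, ?_⟩
    · rw [mem_closedBall_zero_iff, norm_neg, norm_div]
      exact div_le_one_of_le₀ h'.le (norm_nonneg _)
    · rw [hpq]
      nth_rewrite 1 [e]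
      simp only [_root_.mul_inv_rev, inv_inv, rootElt_inv, mul_assoc]

theorem mul_mem_parabolicProd {r : ℕ} {b z : G r} (hb : b ∈ borel r) :
    ∀ {l : List (Fin r)}, z ∈ parabolicProd l → b * z ∈ parabolicProd l
  | [], hz => mul_mem hb hz
  | _ :: _, ⟨p, hp, y, hy, e⟩ =>
    ⟨b * p, mul_mem (borel_le_parabolic _ hb) hp, y, hy, by rw [e, mul_assoc]⟩

theorem exists_parabolicProdReps_mul_borel {r : ℕ} :
    ∀ {l : List (Fin r)} {z : G r}, z ∈ parabolicProd l →
      ∃ k ∈ parabolicProdReps l, ∃ b ∈ borel r, z = k * b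
  | [], z, hz => ⟨1, rfl, z, hz, (one_mul z).symm⟩
  | i :: l, z, ⟨p, hp, y, hy, e⟩ => by
    obtain ⟨k, hk, b, hb, rfl⟩ := exists_reps_mul_borel hp
    obtain ⟨k', hk', b', hb', e'⟩ :=
      exists_parabolicProdReps_mul_borel (mul_mem_parabolicProd hb hy)
    exact ⟨k * k', ⟨k, hk, k', hk', rfl⟩, b', hb', by rw [e, mul_assoc, e', mul_assoc]⟩

theorem parabolicProdReps_subset {r : ℕ} :
    ∀ l : List (Fin r), parabolicProdReps l ⊆ parabolicProd l
  | [], z, hz => by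
    rw [show z = 1 from hz]
    exact one_mem (borel r)
  | i :: l, z, hz => by
    obtain ⟨k, hk, y, hy, rfl⟩ := hz
    refine ⟨k, ?_, y, parabolicProdReps_subset l hy, rfl⟩
    rcases hk with ⟨c, -, rfl⟩ | ⟨c, -, rfl⟩
    · exact lowerElt_mem i c
    · exact mul_mem (borel_le_parabolic _ (upperElt_mem_borel i c))
        (monomial_simpleReflection_subset i (weylLift_mem_monomial _))

theorem cell_subset_parabolicProd {r : ℕ} :
    ∀ l : List (Fin r), cell (wordProd l) ⊆ parabolicProd l
  | [], _, ⟨b, hb, n, hn, b', hb', e⟩ => by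
    rw [e]
    exact mul_mem (mul_mem hb (torus_le_borel r hn)) hb'
  | i :: l, _, ⟨b, hb, n, hn, b', hb', e⟩ => by
    have hs := weylLift_mem_monomial (simpleReflection i)
    set s := weylLift (simpleReflection i)
    have hn' : s⁻¹ * n ∈ monomial (wordProd l) := by
      have := mul_mem_monomial (inv_mem_monomial hs) hn
      rwa [wordProd_cons, inv_mul_cancel_left] at this
    exact ⟨b * s, mul_mem (borel_le_parabolic _ hb) (monomial_simpleReflection_subset i hs),
      s⁻¹ * n * b', cell_subset_parabolicProd l
        (mem_cell_mul (monomial_subset_cell _ hn') hb'), by rw [e]; group⟩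

/-- Each factor `P_i` either leaves the cell unchanged, and the letter `i` is dropped, or prepends
`s_i`. -/
theorem exists_sublist_of_mem_parabolicProd {r : ℕ} :
    ∀ {l : List (Fin r)} {z : G r}, z ∈ parabolicProd l →
      ∃ l' : List (Fin r), l'.Sublist l ∧ z ∈ cell (wordProd l')
  | [], z, hz => ⟨[], List.Sublist.refl _, by
      have := mul_mem_cell hz (monomial_subset_cell 1 (one_mem (torus r)))
      rwa [mul_one] at this⟩
  | i :: l, z, ⟨p, hp, y, hy, e⟩ => by
    obtain ⟨l', hl', hc⟩ := exists_sublist_of_mem_parabolicProd hy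
    rcases minParabolic_mul_mem_cell hp hc with h | h
    · exact ⟨l', hl'.trans (List.sublist_cons_self i l), e ▸ h⟩
    · exact ⟨i :: l', hl'.cons_cons i, by rw [wordProd_cons, e]; exact h⟩

/-- The right side is compact, hence closed, and it already contains the cell. -/
theorem schubert_subset {r : ℕ} (l : List (Fin r)) :
    schubert ∅ (wordProd l) ⊆
      (fun g : G r => (g : FlagVariety (∅ : Set (Fin r)))) '' parabolicProdReps l := by
  rw [schubert_eq]
  refine closure_minimal ?_ ((isCompact_parabolicProdReps l).image
    QuotientGroup.continuous_mk).isClosed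
  rintro _ ⟨g, hg, rfl⟩
  obtain ⟨k, hk, b, hb, rfl⟩ :=
    exists_parabolicProdReps_mul_borel (cell_subset_parabolicProd l hg)
  exact ⟨k, hk, (QuotientGroup.mk_mul_of_mem k hb).symm⟩

theorem isCompact_schubert {r : ℕ} (w : Weyl r) : IsCompact (schubert (∅ : Set (Fin r)) w) := by
  obtain ⟨l, rfl⟩ := exists_wordProd_eq w
  exact ((isCompact_parabolicProdReps l).image QuotientGroup.continuous_mk).of_isClosed_subset
    isClosed_closure (schubert_subset l)

/-- A Schubert variety in `G/B` is covered by the cells of the subwords. -/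
theorem exists_sublist_of_mem_schubert {r : ℕ} {l : List (Fin r)}
    {x : FlagVariety (∅ : Set (Fin r))} (hx : x ∈ schubert ∅ (wordProd l)) :
    ∃ l' : List (Fin r), l'.Sublist l ∧ ∃ g ∈ cell (wordProd l'), (g : FlagVariety ∅) = x := by
  obtain ⟨k, hk, rfl⟩ := schubert_subset l hx
  obtain ⟨l', hl', hc⟩ := exists_sublist_of_mem_parabolicProd (parabolicProdReps_subset l hk)
  exact ⟨l', hl', k, hc, rfl⟩

theorem bruhatLE_of_fixedPoint_mem {r : ℕ} {u w : Weyl r}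
    (h : fixedPoint ∅ u ∈ schubert (∅ : Set (Fin r)) w) : BruhatLE u w := by
  obtain ⟨l, hl⟩ := exists_isReducedWord w
  rw [← hl.1] at h
  obtain ⟨l', hs, g, hg, e⟩ := exists_sublist_of_mem_schubert h
  have h1 := mk_eq_mk_of_cell hg (monomial_subset_cell u (weylLift_mem_monomial u)) e
  rw [QuotientGroup.eq] at h1
  have h2 : wordProd l' = u := inv_mul_eq_one.mp (weylParabolic_empty h1)
  exact h2 ▸ bruhatLE_of_sublist hl hs

/-! ### Fixed points in Schubert varieties -/

theorem mem_cell_simpleReflection {r : ℕ} {i : Fin r} {p : G r}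
    (hp : p ∈ parabolic ({i} : Set (Fin r))) (h : mat p i.succ i.castSucc ≠ 0) :
    p ∈ cell (simpleReflection i) := by
  have hs := weylLift_mem_monomial (simpleReflection i)
  obtain ⟨b, hb, e⟩ := exists_borel_mul_upperElt hp hs h
  refine ⟨b, hb, _, ?_, _, upperElt_mem_borel i _, e⟩
  have := inv_mem_monomial hs
  rwa [inv_eq_of_mul_eq_one_left (simpleReflection_mul_self i)] at this

/-- The elements `lowerElt i c` with `c ≠ 0` lie in the cell and tend to the identity as `c → 0`. -/
theorem one_mem_closure_cell {r : ℕ} (i : Fin r) : (1 : G r) ∈ closure (cell (simpleReflection i)) := by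
  have h : (1 : G r) = lowerElt i 0 := (rootElt_zero _).symm
  rw [h]
  refine map_mem_closure (s := {0}ᶜ) (continuous_rootElt _) ?_ ?_
  · rw [closure_compl_singleton]; trivial
  · intro c hc
    refine mem_cell_simpleReflection (lowerElt_mem i c) ?_
    rw [mat_rootElt, transvection]
    simpa [(castSucc_ne_succ i).symm] using hc

/-- Here `B s_i B` can be rewritten as a root element for the simple root, times `s_i`, times `B`;
since `u` keeps this root positive, the root element passes leftwards through `n` into `B`. -/
theorem mul_mem_cell_of_lt {r : ℕ} {i : Fin r} {u : Weyl r} (hu : u i.castSucc < u i.succ)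
    {g h : G r} (hg : g ∈ cell u) (hh : h ∈ cell (simpleReflection i)) :
    g * h ∈ cell (u * simpleReflection i) := by
  obtain ⟨b1, h1, n, hn, b2, h2, rfl⟩ := hg
  obtain ⟨b3, h3, m, hm, b4, h4, rfl⟩ := hh
  have hs := weylLift_mem_monomial (simpleReflection i)
  set s := weylLift (simpleReflection i)
  have hp : (b2 * b3 * m)⁻¹ ∈ parabolic ({i} : Set (Fin r)) :=
    inv_mem (mul_mem (borel_le_parabolic _ (mul_mem h2 h3)) (monomial_simpleReflection_subset i hm))
  have hne : mat (b2 * b3 * m)⁻¹ i.succ i.castSucc ≠ 0 := by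
    intro h0
    have hb := mul_mem (inv_mem (mul_mem h2 h3)) (inv_mem (mem_borel_of_mem_minParabolic hp h0))
    rw [inv_inv, inv_mul_cancel_left] at hb
    have := monomial_apply_ne_zero hm i.castSucc
    rw [simpleReflection_castSucc] at this
    exact this (mem_borel_iff.mp hb _ _ (by simp [Fin.lt_def]))
  obtain ⟨b, hb, e⟩ := exists_borel_mul_upperElt hp hs hne
  generalize mat (b2 * b3 * m)⁻¹ i.succ i.succ / mat (b2 * b3 * m)⁻¹ i.succ i.castSucc = c at e
  have e2 : b2 * b3 * m = upperElt i (-c) * s * b⁻¹ := by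
    rw [← inv_inv (b2 * b3 * m), e]
    simp only [_root_.mul_inv_rev, inv_inv, rootElt_inv, mul_assoc]
  have hB : n⁻¹⁻¹ * upperElt i (-c) * n⁻¹ ∈ borel r :=
    conj_rootElt_mem_borel (inv_mem_monomial hn) _ (by simpa using hu) _
  refine ⟨b1 * (n⁻¹⁻¹ * upperElt i (-c) * n⁻¹), mul_mem h1 hB, n * s, mul_mem_monomial hn hs,
    b⁻¹ * b4, mul_mem (inv_mem hb) h4, ?_⟩
  calc b1 * n * b2 * (b3 * m * b4) = b1 * n * (b2 * b3 * m) * b4 := by group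
    _ = _ := by rw [e2]; group

/-- Induction on the last letter: by continuity of multiplication, closures of `BuB` and `B s_i B`
multiply into the closure of `B u s_i B` when the length goes up, and the closure of `B s_i B`
contains both `s_i` and `1`. -/
theorem monomial_subset_closure_cell {r : ℕ} (l : List (Fin r)) :
    ∀ l' : List (Fin r), l.length = length (wordProd l) → l'.Sublist l →
      monomial (wordProd l') ⊆ closure (cell (wordProd l)) := by
  induction l using List.reverseRecOn with
  | nil =>
    intro l' _ hs
    rw [List.sublist_nil.mp hs]
    exact (monomial_subset_cell _).trans subset_closure
  | append_singleton l i ih =>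
    intro l' hl hs n hn
    rw [wordProd_append, wordProd_singleton] at hl ⊢
    have hlen := length_wordProd_le l
    have hle := length_mul_simpleReflection_le (wordProd l) i
    simp only [List.length_append, List.length_singleton] at hl
    have hlt : wordProd l i.castSucc < wordProd l i.succ := by
      by_contra h
      have := length_mul_simpleReflection_of_gt
        (lt_of_le_of_ne (not_lt.mp h) (apply_castSucc_ne (wordProd l) i).symm)
      omega
    obtain ⟨l1, l2, rfl, h1, h2⟩ := List.sublist_append_iff.mp hs
    have hm := ih l1 (by omega) h1 (weylLift_mem_monomial _)
    set m := weylLift (wordProd l1) with hmdef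
    have hq : m⁻¹ * n ∈ monomial (wordProd l2) := by
      have := mul_mem_monomial (inv_mem_monomial (weylLift_mem_monomial (wordProd l1))) hn
      rwa [wordProd_append, inv_mul_cancel_left] at this
    have hq' : m⁻¹ * n ∈ closure (cell (simpleReflection i)) := by
      rcases List.sublist_singleton.mp h2 with rfl | rfl
      · have := map_mem_closure (continuous_const_mul (m⁻¹ * n)) (one_mem_closure_cell i)
          (t := cell (simpleReflection i)) fun g hg => mul_mem_cell (torus_le_borel r hq) hg
        simpa using this
      · rw [wordProd_singleton] at hq
        exact subset_closure (monomial_subset_cell _ hq)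
    have := map_mem_closure₂ continuous_mul hm hq'
      (u := cell (wordProd l * simpleReflection i)) fun a ha b hb => mul_mem_cell_of_lt hlt ha hb
    simpa using this

theorem monomial_mem_schubert {r : ℕ} (J : Set (Fin r)) {u w : Weyl r} (h : BruhatLE u w) {n : G r}
    (hn : n ∈ monomial u) : (n : FlagVariety J) ∈ schubert J w := by
  obtain ⟨l, l', ⟨rfl, hl⟩, hs, ⟨rfl, -⟩⟩ := h
  exact mk_mem_schubert_of_mem_closure J (monomial_subset_closure_cell l l' hl hs hn)

theorem fixedPoint_mem_schubert {r : ℕ} (J : Set (Fin r)) {u w : Weyl r} (h : BruhatLE u w) :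
    fixedPoint J u ∈ schubert J w :=
  monomial_mem_schubert J h (weylLift_mem_monomial u)

/-! ### Toric Schubert varieties -/

/-- Over `BwP/P`, the projection from the Schubert variety in `G/B` is injective. -/
theorem eq_mk_of_proj_eq {r : ℕ} {J : Set (Fin r)} {w : Weyl r} (hw : w ∈ minCosetReps J)
    {x : FlagVariety (∅ : Set (Fin r))} (hx : x ∈ schubert ∅ w) {h : G r} (hh : h ∈ cell w)
    (he : proj J x = (h : FlagVariety J)) : x = (h : FlagVariety ∅) := by
  obtain ⟨l, rfl, hl⟩ := exists_isReducedWord w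
  obtain ⟨l', hs, g, hg, rfl⟩ := exists_sublist_of_mem_schubert hx
  have h1 := mk_eq_mk_of_cell hg hh he
  -- Minimality of `w` in its coset leaves no room for `l'` to be shorter than `l`.
  have h2 := hw _ (QuotientGroup.eq.mp h1.symm)
  rw [mul_inv_cancel_left] at h2
  have h3 := hs.eq_of_length (hs.length_le.antisymm (hl ▸ h2.trans (length_wordProd_le l')))
  subst h3
  exact mk_borel_eq_of_mk_eq hw hg hh he

/-- The open orbit meets the dense cell, so its base point may be taken there. -/
theorem exists_generic_of_isToric {r : ℕ} {J : Set (Fin r)} {w : Weyl r}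
    (h : IsToric (schubert J w)) :
    ∃ g ∈ cell w, schubert J w ⊆ closure (MulAction.orbit (torus r) (g : FlagVariety J)) ∧
      ∃ U : Set (FlagVariety J), IsOpen U ∧
        U ∩ schubert J w = MulAction.orbit (torus r) (g : FlagVariety J) := by
  obtain ⟨x, hx, -, hcl, U, hU, hUX⟩ := h
  have hxU : x ∈ U := (hUX.symm ▸ MulAction.mem_orbit_self x : x ∈ U ∩ schubert J w).1
  rw [schubert_eq] at hx
  obtain ⟨_, hyU, g, hg, rfl⟩ := mem_closure_iff.mp hx U hU hxU
  have hgX : (g : FlagVariety J) ∈ schubert J w := by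
    rw [schubert_eq]
    exact subset_closure ⟨g, hg, rfl⟩
  have hgo : (g : FlagVariety J) ∈ MulAction.orbit (torus r) x := hUX ▸ ⟨hyU, hgX⟩
  have ho := MulAction.orbit_eq_iff.mpr hgo
  exact ⟨g, hg, ho ▸ hcl, U, hU, ho ▸ hUX⟩

theorem mk_mem_schubert {r : ℕ} (J : Set (Fin r)) {w : Weyl r} {g : G r} (hg : g ∈ cell w) :
    (g : FlagVariety J) ∈ schubert J w :=
  mk_mem_schubert_of_mem_closure J (subset_closure hg)

theorem orbit_subset_schubert {r : ℕ} {J : Set (Fin r)} {w : Weyl r} {x : FlagVariety J}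
    (hx : x ∈ schubert J w) : MulAction.orbit (torus r) x ⊆ schubert J w := by
  rintro _ ⟨t, rfl⟩
  exact smul_mem_schubert t hx

/-- The image in `G/P` of the orbit closure is compact and contains the dense orbit downstairs, so
it contains `BwP/P`; one-point fibres then put `BwB/B` into the orbit closure upstairs. -/
theorem schubert_subset_closure_orbit {r : ℕ} {J : Set (Fin r)} {w : Weyl r}
    (hw : w ∈ minCosetReps J) {g : G r} (hg : g ∈ cell w)
    (hd : schubert J w ⊆ closure (MulAction.orbit (torus r) (g : FlagVariety J))) :
    schubert ∅ w ⊆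
      closure (MulAction.orbit (torus r) (g : FlagVariety (∅ : Set (Fin r)))) := by
  set O := closure (MulAction.orbit (torus r) (g : FlagVariety (∅ : Set (Fin r)))) with hO
  have hOX : O ⊆ schubert ∅ w :=
    closure_minimal (orbit_subset_schubert (mk_mem_schubert ∅ hg)) isClosed_closure
  have hc : IsClosed (proj J '' O) :=
    (((isCompact_schubert w).of_isClosed_subset isClosed_closure hOX).image
      (continuous_proj J)).isClosed
  have hsub : closure (MulAction.orbit (torus r) (g : FlagVariety J)) ⊆ proj J '' O := by
    refine closure_minimal ?_ hc
    rintro _ ⟨t, rfl⟩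
    exact ⟨_, subset_closure ⟨t, rfl⟩, rfl⟩
  rw [schubert_eq]
  refine closure_minimal ?_ isClosed_closure
  rintro _ ⟨h, hh, rfl⟩
  obtain ⟨z, hz, e⟩ := hsub (hd (mk_mem_schubert J hh))
  rw [eq_mk_of_proj_eq hw (hOX hz) hh e] at hz
  exact hz

theorem isToric_schubert_borel {r : ℕ} {J : Set (Fin r)} {w : Weyl r} (hw : w ∈ minCosetReps J)
    (h : IsToric (schubert J w)) : IsToric (schubert (∅ : Set (Fin r)) w) := by
  obtain ⟨g, hg, hd, U, hU, hUX⟩ := exists_generic_of_isToric h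
  refine ⟨(g : FlagVariety ∅), mk_mem_schubert ∅ hg, orbit_subset_schubert (mk_mem_schubert ∅ hg),
    schubert_subset_closure_orbit hw hg hd, proj J ⁻¹' U, hU.preimage (continuous_proj J), ?_⟩
  ext z
  constructor
  · rintro ⟨hzU, hz⟩
    have : proj J z ∈ MulAction.orbit (torus r) (g : FlagVariety J) :=
      hUX ▸ ⟨hzU, proj_mem_schubert J hz⟩
    obtain ⟨t, ht⟩ := this
    exact ⟨t, (eq_mk_of_proj_eq hw hz (mul_mem_cell (torus_le_borel r t.2) hg) ht.symm).symm⟩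
  · rintro ⟨t, rfl⟩
    have : t • (g : FlagVariety J) ∈ U ∩ schubert J w := hUX.symm ▸ ⟨t, rfl⟩
    exact ⟨this.1, smul_mem_schubert t (mk_mem_schubert ∅ hg)⟩

theorem fixes_schubert_iff {r : ℕ} {J : Set (Fin r)} {w : Weyl r} (hw : w ∈ minCosetReps J)
    (t : torus r) : (∀ x ∈ schubert J w, t • x = x) ↔
      ∀ x ∈ schubert (∅ : Set (Fin r)) w, t • x = x := by
  constructor
  · intro h
    rw [schubert_eq]
    refine closure_minimal (t := {x | t • x = x}) ?_
      (isClosed_eq (continuous_torus_smul t) continuous_id)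
    rintro _ ⟨g, hg, rfl⟩
    exact mk_borel_eq_of_mk_eq hw (mul_mem_cell (torus_le_borel r t.2) hg) hg
      (h _ (mk_mem_schubert J hg))
  · intro h
    rw [schubert_eq]
    refine closure_minimal (t := {x | t • x = x}) ?_
      (isClosed_eq (continuous_torus_smul t) continuous_id)
    rintro _ ⟨g, hg, rfl⟩
    exact congrArg (proj J) (h _ (mk_mem_schubert ∅ hg))

theorem charLattice_schubert_eq {r : ℕ} {J : Set (Fin r)} {w : Weyl r}
    (hw : w ∈ minCosetReps J) :
    charLattice (schubert J w) = charLattice (schubert (∅ : Set (Fin r)) w) :=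
  Subgroup.ext fun _ => and_congr_right fun _ => forall_congr' fun t =>
    imp_congr (fixes_schubert_iff hw t) Iff.rfl

/-! ### Characters and one-parameter subgroups -/

theorem torus_apply_ne_zero {r : ℕ} (t : torus r) (i : Fin (r + 1)) : mat t.1 i i ≠ 0 :=
  monomial_apply_ne_zero (mem_monomial_one_iff.mpr t.2) i

theorem torus_mul_apply {r : ℕ} (t : torus r) (g : G r) (i j : Fin (r + 1)) :
    mat (t.1 * g) i j = mat t.1 i i * mat g i j :=
  monomial_mul_apply (mem_monomial_one_iff.mpr t.2) g i j

/-- The character of `T` given by a Laurent monomial in the diagonal entries. -/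
noncomputable def monomialChar {r : ℕ} (m : Fin (r + 1) → ℤ) : torus r →* ℂˣ where
  toFun t := ∏ i, (Units.mk0 (mat t.1 i i) (torus_apply_ne_zero t i)) ^ m i
  map_one' := by
    refine Finset.prod_eq_one fun i _ => ?_
    have : Units.mk0 (mat (1 : torus r).1 i i) (torus_apply_ne_zero 1 i) = 1 :=
      Units.ext (Matrix.one_apply_eq i)
    rw [this, _root_.one_zpow]
  map_mul' s t := by
    rw [← Finset.prod_mul_distrib]
    refine Finset.prod_congr rfl fun i _ => ?_
    rw [← mul_zpow]
    congr 1
    exact Units.ext (torus_mul_apply s t.1 i i)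

theorem monomialChar_apply {r : ℕ} (m : Fin (r + 1) → ℤ) (t : torus r) :
    (monomialChar m t : ℂ) = ∏ i, (mat t.1 i i) ^ m i := by
  simp [monomialChar]

theorem eq_monomialChar {r : ℕ} {χ : torus r →* ℂˣ} {m : Fin (r + 1) → ℤ}
    (h : ∀ t : torus r, (χ t : ℂ) = ∏ i, (mat t.1 i i) ^ m i) : χ = monomialChar m :=
  MonoidHom.ext fun t => Units.ext (by rw [h, monomialChar_apply])

theorem monomialChar_add {r : ℕ} (m k : Fin (r + 1) → ℤ) :
    monomialChar (m + k) = (monomialChar m * monomialChar k : torus r →* ℂˣ) := by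
  refine MonoidHom.ext fun t => Units.ext ?_
  simp only [MonoidHom.mul_apply, Units.val_mul, monomialChar_apply, ← Finset.prod_mul_distrib,
    Pi.add_apply]
  exact Finset.prod_congr rfl fun i _ => zpow_add₀ (torus_apply_ne_zero t i) _ _

theorem monomialChar_one {r : ℕ} : (monomialChar 1 : torus r →* ℂˣ) = 1 := by
  refine MonoidHom.ext fun t => Units.ext ?_
  have hdet : (mat t.1).det = 1 := t.1.2
  rw [Matrix.det_of_isUpperTriangular (fun i j hij => t.2 i j (ne_of_gt hij))] at hdet
  simpa [monomialChar_apply] using hdet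

/-- The one-parameter subgroup `s ↦ diag(exp(-s bᵢ))` of `T`. -/
noncomputable def oneParam {r : ℕ} (b : Fin (r + 1) → ℝ) (hb : ∑ i, b i = 0) (s : ℝ) : torus r :=
  ⟨⟨Matrix.diagonal fun i => (Real.exp (-(s * b i)) : ℂ), by
    rw [Matrix.det_diagonal, ← Complex.ofReal_prod, ← Real.exp_sum, Finset.sum_neg_distrib,
      ← Finset.mul_sum, hb]
    simp⟩, fun _ _ h => Matrix.diagonal_apply_ne _ h⟩

theorem oneParam_apply {r : ℕ} {b : Fin (r + 1) → ℝ} (hb : ∑ i, b i = 0) (s : ℝ)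
    (i : Fin (r + 1)) : mat (oneParam b hb s).1 i i = (Real.exp (-(s * b i)) : ℂ) :=
  Matrix.diagonal_apply_eq _ i

theorem monomialChar_oneParam {r : ℕ} {b : Fin (r + 1) → ℝ} (hb : ∑ i, b i = 0) (s : ℝ)
    (m : Fin (r + 1) → ℤ) :
    (monomialChar m (oneParam b hb s) : ℂ) = (Real.exp (-(s * ∑ i, m i * b i)) : ℂ) := by
  rw [monomialChar_apply, Finset.mul_sum, ← Finset.sum_neg_distrib, Real.exp_sum,
    Complex.ofReal_prod]
  refine Finset.prod_congr rfl fun i _ => ?_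
  rw [oneParam_apply, ← Complex.ofReal_zpow, ← Real.rpow_intCast, ← Real.exp_mul]
  congr 2
  ring

/-! ### Regular functions on charts -/

theorem continuous_eval_mat {r : ℕ} (p : MvPolynomial (Fin (r + 1) × Fin (r + 1)) ℂ) :
    Continuous fun g : G r => MvPolynomial.eval (fun q => mat g q.1 q.2) p :=
  (MvPolynomial.continuous_eval p).comp (continuous_pi fun q => continuous_mat_apply q.1 q.2)

theorem mem_closure_preimage_mk {r : ℕ} {J : Set (Fin r)} {S : Set (FlagVariety J)} {g : G r}
    (h : (g : FlagVariety J) ∈ closure S) :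
    g ∈ closure ((fun g : G r => (g : FlagVariety J)) ⁻¹' S) := by
  rw [← (QuotientGroup.isOpenMap_coe).preimage_closure_eq_closure_preimage
    QuotientGroup.continuous_mk]
  exact h

theorem orbit_subset_chart {r : ℕ} {J : Set (Fin r)} {X : Set (FlagVariety J)}
    {x y : FlagVariety J} (horb : MulAction.orbit (torus r) x ⊆ X)
    (hX : X ⊆ closure (MulAction.orbit (torus r) x)) (hy : y ∈ X) :
    MulAction.orbit (torus r) x ⊆ chart X y := by
  intro z hz
  refine ⟨horb hz, ?_⟩
  rw [MulAction.orbit_eq_iff.mpr hz]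
  exact hX hy

/-- A semi-invariant regular function which is not identically zero does not vanish on the open
orbit. -/
theorem regular_apply_ne_zero {r : ℕ} {J : Set (Fin r)} {X : Set (FlagVariety J)}
    {x y : FlagVariety J} (horb : MulAction.orbit (torus r) x ⊆ X)
    (hX : X ⊆ closure (MulAction.orbit (torus r) x)) (hy : y ∈ X) {χ : torus r →* ℂˣ}
    {f : FlagVariety J → ℂ} (hf : IsRegularOn (chart X y) f) (hne : ∃ z ∈ chart X y, f z ≠ 0)
    (hχ : ∀ t : torus r, ∀ z ∈ chart X y, f (t • z) = (χ t : ℂ) * f z) : f x ≠ 0 := by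
  intro h0
  obtain ⟨z, hz, hfz⟩ := hne
  have hsub := orbit_subset_chart horb hX hy
  have hxc : x ∈ chart X y := hsub (MulAction.mem_orbit_self x)
  have h0' : ∀ z' ∈ MulAction.orbit (torus r) x, f z' = 0 := by
    rintro _ ⟨t, rfl⟩
    exact (hχ t x hxc).trans (by rw [h0, mul_zero])
  obtain ⟨g, rfl⟩ := QuotientGroup.mk_surjective z
  obtain ⟨a, b, hb, hab⟩ := hf g hz
  have hcl := mem_closure_preimage_mk (hX hz.1)
  -- The local equation `a = 0` makes sense only where `b ≠ 0`; the product `a * b` vanishes on the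
  -- whole preimage of the orbit, and so on its closure.
  have hprod : MvPolynomial.eval (fun q => mat g q.1 q.2) a *
      MvPolynomial.eval (fun q => mat g q.1 q.2) b = 0 := by
    refine closure_minimal (t := {g : G r | MvPolynomial.eval (fun q => mat g q.1 q.2) a *
      MvPolynomial.eval (fun q => mat g q.1 q.2) b = 0}) ?_ (isClosed_eq
        ((continuous_eval_mat a).mul (continuous_eval_mat b)) continuous_const) hcl
    intro h hh
    by_cases hbh : MvPolynomial.eval (fun q => mat h q.1 q.2) b = 0
    · exact mul_eq_zero_of_right _ hbh
    · have := hab h (hsub hh) hbh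
      rw [h0' _ hh, eq_comm, div_eq_zero_iff] at this
      exact mul_eq_zero_of_left (this.resolve_right hbh) _
  refine hfz ?_
  rw [hab g hz hb, (mul_eq_zero.mp hprod).resolve_right hb, zero_div]

/-- If a one-parameter subgroup moves the generic point into a point `y`, then it pairs
non-negatively with the characters which are regular on the chart at `y`. -/
theorem nonneg_of_isRegularChar {r : ℕ} {J : Set (Fin r)} {X : Set (FlagVariety J)}
    {x : FlagVariety J} (horb : MulAction.orbit (torus r) x ⊆ X)
    (hX : X ⊆ closure (MulAction.orbit (torus r) x)) {g : G r} (hg : (g : FlagVariety J) ∈ X)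
    {b : Fin (r + 1) → ℝ} (hb : ∑ i, b i = 0) {h : ℝ → G r} (hlim : Tendsto h atTop (𝓝 g))
    (hh : ∀ s, (h s : FlagVariety J) = oneParam b hb s • x) {m : Fin (r + 1) → ℤ}
    (hχ : IsRegularChar X (g : FlagVariety J) (monomialChar m)) : 0 ≤ ∑ i, m i * b i := by
  obtain ⟨f, hf, hne, hft⟩ := hχ
  have hfx := regular_apply_ne_zero horb hX hg hf hne hft
  have hsub := orbit_subset_chart horb hX hg
  have hgc : (g : FlagVariety J) ∈ chart X (g : FlagVariety J) :=
    ⟨hg, subset_closure (MulAction.mem_orbit_self _)⟩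
  obtain ⟨p, q, hq, hpq⟩ := hf g hgc
  have hlim' : Tendsto (fun s => MvPolynomial.eval (fun i => mat (h s) i.1 i.2) p /
      MvPolynomial.eval (fun i => mat (h s) i.1 i.2) q) atTop
      (𝓝 (MvPolynomial.eval (fun i => mat g i.1 i.2) p /
        MvPolynomial.eval (fun i => mat g i.1 i.2) q)) :=
    (((continuous_eval_mat p).tendsto g).comp hlim).div
      (((continuous_eval_mat q).tendsto g).comp hlim) hq
  -- A negative pairing would make the norm of `f` grow exponentially along the path, although `f`
  -- is there a quotient with a finite limit.
  by_contra hneg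
  rw [not_le] at hneg
  set β := ∑ i, (m i : ℝ) * b i with hβ
  have hnorm : Tendsto (fun s : ℝ => Real.exp (-(s * β)) * ‖f x‖) atTop atTop := by
    refine Tendsto.atTop_mul_const (norm_pos_iff.mpr hfx) (Real.tendsto_exp_atTop.comp ?_)
    have := tendsto_id.atTop_mul_const (neg_pos.mpr hneg) (β := ℝ) (l := atTop)
    refine this.congr fun s => ?_
    simp
  refine not_tendsto_nhds_of_tendsto_atTop hnorm _ ((hlim'.norm).congr' ?_)
  filter_upwards [(((continuous_eval_mat q).tendsto g).comp hlim).eventually_ne hq] with s hs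
  have hs' : (h s : FlagVariety J) ∈ chart X (g : FlagVariety J) := by
    rw [hh]; exact hsub ⟨_, rfl⟩
  rw [← hpq (h s) hs' hs, hh, hft _ x (hsub (MulAction.mem_orbit_self x)), norm_mul,
    monomialChar_oneParam, Complex.norm_real, Real.norm_eq_abs, Real.abs_exp]

/-- A point where `f` is nonzero need not lie in the image of the chart upstairs; non-vanishing on
the open orbit takes care of this. -/
theorem isRegularChar_pullback {r : ℕ} {J : Set (Fin r)} {X : Set (FlagVariety J)}
    {Y : Set (FlagVariety (∅ : Set (Fin r)))} {x y : FlagVariety (∅ : Set (Fin r))}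
    (hYX : ∀ z ∈ Y, proj J z ∈ X) (horb : MulAction.orbit (torus r) x ⊆ Y)
    (hY : Y ⊆ closure (MulAction.orbit (torus r) x)) (hy : y ∈ Y)
    (hX : X ⊆ closure (MulAction.orbit (torus r) (proj J x))) {χ : torus r →* ℂˣ}
    (h : IsRegularChar X (proj J y) χ) : IsRegularChar Y y χ := by
  obtain ⟨f, hf, hne, hft⟩ := h
  have hchart : ∀ z ∈ chart Y y, proj J z ∈ chart X (proj J y) := by
    rintro z ⟨hz, hcl⟩
    refine ⟨hYX z hz, map_mem_closure (continuous_proj J) hcl ?_⟩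
    rintro _ ⟨t, rfl⟩
    exact ⟨t, (proj_smul J t z).symm⟩
  have horb' : MulAction.orbit (torus r) (proj J x) ⊆ X := by
    rintro _ ⟨t, rfl⟩
    have := hYX _ (horb ⟨t, rfl⟩)
    rwa [proj_smul] at this
  refine ⟨f ∘ proj J, ?_, ⟨x, orbit_subset_chart horb hY hy (MulAction.mem_orbit_self x),
    regular_apply_ne_zero horb' hX (hYX y hy) hf hne hft⟩, ?_⟩
  · intro g hg
    obtain ⟨a, b, hb, hab⟩ := hf g (hchart _ hg)
    exact ⟨a, b, hb, fun h hh => hab h (hchart _ hh)⟩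
  · intro t z hz
    rw [Function.comp_apply, proj_smul]
    exact hft t _ (hchart z hz)

/-! ### Minors -/

/-- The minor of `g` in the columns `j ≤ k` and the rows `u j`, `j ≤ k`. -/
noncomputable def minor {r : ℕ} (k : Fin r) (u : Weyl r) (g : G r) : ℂ :=
  Matrix.det (Matrix.of fun i j : {j : Fin (r + 1) // j ≤ k.castSucc} => mat g (u i) j)

/-- The polynomial in the matrix entries which gives a minor. -/
noncomputable def minorPoly {r : ℕ} (k : Fin r) (u : Weyl r) :
    MvPolynomial (Fin (r + 1) × Fin (r + 1)) ℂ :=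
  Matrix.det (Matrix.of fun i j : {j : Fin (r + 1) // j ≤ k.castSucc} =>
    MvPolynomial.X (u i.1, j.1))

/-- The exponents of the weight of a minor. -/
def minorWeight {r : ℕ} (k : Fin r) (u : Weyl r) (i : Fin (r + 1)) : ℤ :=
  if u⁻¹ i ≤ k.castSucc then 1 else 0

theorem eval_minorPoly {r : ℕ} (k : Fin r) (u : Weyl r) (g : G r) :
    MvPolynomial.eval (fun q => mat g q.1 q.2) (minorPoly k u) = minor k u g := by
  rw [minorPoly, RingHom.map_det, minor]
  congr 1
  ext i j
  simp

theorem continuous_minor {r : ℕ} (k : Fin r) (u : Weyl r) : Continuous (minor k u) := by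
  simpa only [eval_minorPoly] using continuous_eval_mat (minorPoly k u)

/-- These minors are Plücker coordinates: for `k ∉ J` the columns of `g * p` up to `k` are
combinations of the columns of `g` up to `k`, so all minors are multiplied by one common factor. -/
theorem minor_mul_parabolic {r : ℕ} {J : Set (Fin r)} {k : Fin r} (hk : k ∉ J) (u : Weyl r)
    (g : G r) {p : G r} (hp : p ∈ parabolic J) :
    minor k u (g * p) = minor k u g * minor k 1 p := by
  rw [minor, minor, minor, ← Matrix.det_mul]
  congr 1
  ext i j
  rw [Matrix.mul_apply]
  simp only [Matrix.of_apply, Equiv.Perm.one_apply, mat_mul_apply]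
  rw [← Finset.sum_subtype (Finset.univ.filter (· ≤ k.castSucc)) (by simp)
    (fun l => mat g (u i) l * mat p l j)]
  symm
  refine Finset.sum_filter_of_ne fun l _ hl => ?_
  by_contra h
  exact hl (mul_eq_zero_of_right _ (hp k hk l j j.2 (not_le.mp h)))

theorem minor_monomial_ne_zero {r : ℕ} (k : Fin r) {u : Weyl r} {n : G r} (hn : n ∈ monomial u) :
    minor k u n ≠ 0 := by
  have h : (Matrix.of fun i j : {j : Fin (r + 1) // j ≤ k.castSucc} => mat n (u i) j) =
      Matrix.diagonal fun i : {j : Fin (r + 1) // j ≤ k.castSucc} => mat n (u i) i := by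
    ext i j
    by_cases hij : i = j
    · subst hij; simp
    · rw [Matrix.diagonal_apply_ne _ hij, Matrix.of_apply]
      exact hn _ _ fun he => hij (Subtype.ext (u.injective he))
  rw [minor, h, Matrix.det_diagonal]
  exact Finset.prod_ne_zero_iff.mpr fun i _ => monomial_apply_ne_zero hn i

theorem minor_one_ne_zero {r : ℕ} {J : Set (Fin r)} {k : Fin r} (hk : k ∉ J) {p : G r}
    (hp : p ∈ parabolic J) : minor k 1 p ≠ 0 := by
  have h := minor_mul_parabolic hk 1 p (inv_mem hp)
  rw [mul_inv_cancel] at h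
  exact fun h0 => minor_monomial_ne_zero k (one_mem (torus r)) (by rw [h, h0, zero_mul])

theorem monomialChar_minorWeight {r : ℕ} (k : Fin r) (u : Weyl r) (t : torus r) :
    (monomialChar (minorWeight k u) t : ℂ) =
      ∏ i : {j : Fin (r + 1) // j ≤ k.castSucc}, mat t.1 (u i) (u i) := by
  rw [monomialChar_apply, ← Equiv.prod_comp u,
    ← Finset.prod_subtype (Finset.univ.filter (· ≤ k.castSucc)) (by simp)
      (fun i => mat t.1 (u i) (u i)), Finset.prod_filter]
  refine Finset.prod_congr rfl fun i _ => ?_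
  rw [minorWeight, weyl_inv_apply]
  split_ifs <;> simp

theorem minor_torus_mul {r : ℕ} (k : Fin r) (u : Weyl r) (t : torus r) (g : G r) :
    minor k u (t.1 * g) = (monomialChar (minorWeight k u) t : ℂ) * minor k u g := by
  rw [monomialChar_minorWeight, minor, minor, ← Matrix.det_mul_column]
  congr 1
  ext i j
  exact torus_mul_apply t g _ _

/-- Vanishing of the minor is a closed condition stable under `T` and `P`, and it fails at `uP`. -/
theorem minor_ne_zero_of_mem_closure {r : ℕ} {J : Set (Fin r)} {k : Fin r} (hk : k ∉ J)
    {u : Weyl r} {g : G r}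
    (h : fixedPoint J u ∈ closure (MulAction.orbit (torus r) (g : FlagVariety J))) :
    minor k u g ≠ 0 := by
  intro h0
  refine minor_monomial_ne_zero k (weylLift_mem_monomial u) ?_
  refine closure_minimal (t := {g : G r | minor k u g = 0}) ?_
    (isClosed_eq (continuous_minor k u) continuous_const) (mem_closure_preimage_mk h)
  rintro g' ⟨t, ht⟩
  have hp : (t.1 * g)⁻¹ * g' ∈ parabolic J := QuotientGroup.eq.mp ht
  have e := minor_mul_parabolic hk u (t.1 * g) hp
  rw [mul_inv_cancel_left, minor_torus_mul, h0, mul_zero, zero_mul] at e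
  exact e

theorem monomialChar_sub_apply {r : ℕ} (m k : Fin (r + 1) → ℤ) (t : torus r) :
    (monomialChar (m - k) t : ℂ) = monomialChar m t / monomialChar k t := by
  rw [eq_div_iff (monomialChar k t).ne_zero]
  have h := congrArg (fun χ => (χ t : ℂ)) (monomialChar_add (m - k) k)
  simpa using h.symm

/-- The quotient of two minors is a semi-invariant function which is regular on a chart. -/
theorem minor_quotient_regular {r : ℕ} {J : Set (Fin r)} {X : Set (FlagVariety J)} {g : G r}
    (hg : (g : FlagVariety J) ∈ X)
    (hX : X ⊆ closure (MulAction.orbit (torus r) (g : FlagVariety J))) {u v : Weyl r}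
    (hu : fixedPoint J u ∈ X) (hv : fixedPoint J v ∈ X) {k : Fin r} (hk : k ∉ J) :
    monomialChar (minorWeight k u - minorWeight k v) ∈ charLattice X ∧
      IsRegularChar X (fixedPoint J v) (monomialChar (minorWeight k u - minorWeight k v)) := by
  have hu0 := minor_ne_zero_of_mem_closure hk (hX hu)
  have hv0 := minor_ne_zero_of_mem_closure hk (hX hv)
  have hquot : ∀ h h' : G r, (h : FlagVariety J) = (h' : FlagVariety J) →
      minor k u h / minor k v h = minor k u h' / minor k v h' := by
    intro h h' he
    have hp := QuotientGroup.eq.mp he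
    have e1 := minor_mul_parabolic hk u h hp
    have e2 := minor_mul_parabolic hk v h hp
    rw [mul_inv_cancel_left] at e1 e2
    rw [e1, e2, mul_div_mul_right _ _ (minor_one_ne_zero hk hp)]
  have hout : ∀ h : G r, minor k u (h : FlagVariety J).out / minor k v (h : FlagVariety J).out =
      minor k u h / minor k v h := fun h => hquot _ _ (QuotientGroup.out_eq' _)
  have htrans : ∀ (t : torus r) (h : G r), minor k u (t.1 * h) / minor k v (t.1 * h) =
      (monomialChar (minorWeight k u - minorWeight k v) t : ℂ) *
        (minor k u h / minor k v h) := fun t h => by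
    rw [minor_torus_mul, minor_torus_mul, monomialChar_sub_apply, mul_div_mul_comm]
  refine ⟨⟨⟨_, monomialChar_apply _⟩, fun t ht => Units.ext ?_⟩,
    fun z => minor k u z.out / minor k v z.out, ?_, ⟨_, ⟨hg, hX hv⟩, ?_⟩, ?_⟩
  · have e := hquot (t.1 * g) g (ht _ hg)
    rw [htrans] at e
    exact (mul_eq_right₀ (div_ne_zero hu0 hv0)).mp e
  · intro h hh
    refine ⟨minorPoly k u, minorPoly k v, ?_, fun h' _ _ => ?_⟩
    · rw [eval_minorPoly]
      exact minor_ne_zero_of_mem_closure hk hh.2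
    · rw [eval_minorPoly, eval_minorPoly]
      exact hout h'
  · exact fun h0 => div_ne_zero hu0 hv0 ((hout g).symm.trans h0)
  · intro t z _
    obtain ⟨h, rfl⟩ := QuotientGroup.mk_surjective z
    rw [smul_mk]
    beta_reduce
    rw [hout, hout, htrans]

/-! ### Coordinates on the fan space -/

/-- A divisible group such as `ℝ` is injective over `ℤ`, so a homomorphism on the subgroup of
exponents with `F m ∈ S` extends to all exponents and is read off on the standard basis. -/
theorem exists_coordinates_of_subgroup {ι A : Type*} [Fintype ι] [DecidableEq ι] [CommGroup A]
    (S : Subgroup A) (F : (ι → ℤ) → A) (hF : ∀ m k, F (m + k) = F m * F k)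
    (ν : Additive S →+ ℝ) :
    ∃ a : ι → ℝ, ∀ (m : ι → ℤ) (h : F m ∈ S),
      ν (Additive.ofMul ⟨F m, h⟩) = ∑ i, m i * a i := by
  let F' : (ι → ℤ) →+ Additive A := AddMonoidHom.mk' (fun m => Additive.ofMul (F m)) hF
  let L : AddSubgroup (ι → ℤ) := (Subgroup.toAddSubgroup S).comap F'
  let φ : L →+ ℝ := AddMonoidHom.mk'
    (fun m => ν (Additive.ofMul ⟨F m.1, m.2⟩)) fun m k => by
      rw [← map_add]
      congr 1
      exact Subtype.ext (hF m.1 k.1)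
  obtain ⟨ψ, hψ⟩ := (Module.Baer.of_divisible ℝ).extension_property_addMonoidHom L.subtype
    Subtype.val_injective φ
  refine ⟨fun i => ψ (Pi.single i 1), fun m h => ?_⟩
  have h1 : ν (Additive.ofMul ⟨F m, h⟩) = ψ m := (DFunLike.congr_fun hψ (⟨m, h⟩ : L)).symm
  have h2 : m = ∑ i, m i • Pi.single i (1 : ℤ) := by
    ext j
    simp [Finset.sum_apply, Pi.single_apply]
  rw [h1]
  conv_lhs => rw [h2]
  rw [map_sum]
  exact Finset.sum_congr rfl fun i _ => by rw [map_zsmul, zsmul_eq_mul]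

theorem exists_coordinates {r : ℕ} {J : Set (Fin r)} {X : Set (FlagVariety J)} (ν : FanSpace X) :
    ∃ a : Fin (r + 1) → ℝ, ∑ i, a i = 0 ∧
      ∀ (m : Fin (r + 1) → ℤ) (h : monomialChar m ∈ charLattice X),
        ν (Additive.ofMul ⟨monomialChar m, h⟩) = ∑ i, m i * a i := by
  obtain ⟨a, ha⟩ := exists_coordinates_of_subgroup (charLattice X) monomialChar
    monomialChar_add ν
  refine ⟨a, ?_, ha⟩
  -- The determinant is trivial on `T`, which forces the coordinates to sum to zero.
  have h1 : monomialChar 1 ∈ charLattice X := by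
    rw [monomialChar_one]; exact one_mem _
  have h2 := ha 1 h1
  have h3 : (⟨monomialChar 1, h1⟩ : charLattice X) = 1 := Subtype.ext monomialChar_one
  rw [h3, ofMul_one, map_zero] at h2
  simpa using h2.symm

/-! ### Limits of one-parameter subgroups -/

/-- Gaussian elimination by columns, for an arbitrary order of the rows. -/
theorem exists_pivots {r : ℕ} {α : Type*} [LinearOrder α] {κ : Fin (r + 1) → α}
    (hκ : Function.Injective κ) (g : G r) :
    ∃ u : Weyl r, ∃ b ∈ borel r, ∀ i j, κ i < κ (u j) → mat (g * b) i j = 0 := by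
  classical
  -- The candidates for column `j` of a unipotent upper triangular matrix. Among them choose one
  -- whose image under `g` has its first nonzero row, in the order `κ`, as late as possible.
  let S : Fin (r + 1) → Set (Fin (r + 1) → ℂ) := fun j => {x | x j = 1 ∧ ∀ l, j < l → x l = 0}
  let y : (Fin (r + 1) → ℂ) → Fin (r + 1) → ℂ := fun x => mat g *ᵥ x
  have hlead : ∀ j, ∀ x ∈ S j, ∃ i, y x i ≠ 0 ∧ ∀ i', κ i' < κ i → y x i' = 0 := by
    intro j x hx
    have hne : y x ≠ 0 := by
      intro h0
      have h1 : mat g⁻¹ *ᵥ y x = x := by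
        rw [Matrix.mulVec_mulVec]
        have : mat g⁻¹ * mat g = 1 := congrArg mat (inv_mul_cancel g)
        rw [this, Matrix.one_mulVec]
      rw [h0, Matrix.mulVec_zero] at h1
      have h2 := hx.1
      rw [← h1] at h2
      exact zero_ne_one h2
    obtain ⟨i0, hi0⟩ := Function.ne_iff.mp hne
    obtain ⟨i, hi, hmin⟩ := Finset.exists_min_image (Finset.univ.filter fun i => y x i ≠ 0) κ
      ⟨i0, by simpa using hi0⟩
    refine ⟨i, by simpa using hi, fun i' hi' => ?_⟩
    by_contra h
    exact absurd (hmin i' (by simpa using h)) (not_le.mpr hi')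
  have hmax : ∀ j, ∃ i x, x ∈ S j ∧ (y x i ≠ 0 ∧ ∀ i', κ i' < κ i → y x i' = 0) ∧
      ∀ x' ∈ S j, ∃ i', κ i' ≤ κ i ∧ y x' i' ≠ 0 := by
    intro j
    have hne : (Finset.univ.filter fun i =>
        ∃ x ∈ S j, y x i ≠ 0 ∧ ∀ i', κ i' < κ i → y x i' = 0).Nonempty := by
      have hx : Pi.single j 1 ∈ S j := ⟨Pi.single_eq_same _ _, fun l hl =>
        Pi.single_eq_of_ne hl.ne' _⟩
      obtain ⟨i, hi⟩ := hlead j _ hx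
      exact ⟨i, by simpa using ⟨_, hx, hi⟩⟩
    obtain ⟨i, hi, hm⟩ := Finset.exists_max_image _ κ hne
    obtain ⟨x, hx, hxi⟩ := (Finset.mem_filter.mp hi).2
    refine ⟨i, x, hx, hxi, fun x' hx' => ?_⟩
    obtain ⟨i', hi'⟩ := hlead j x' hx'
    exact ⟨i', hm i' (Finset.mem_filter.mpr ⟨Finset.mem_univ _, x', hx', hi'⟩), hi'.1⟩
  choose piv x hxS hpiv hpmax using hmax
  -- If two pivots agreed, subtracting a multiple of the earlier column would move the pivot of the
  -- later one further, against maximality.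
  have hinj' : ∀ j j', j < j' → piv j ≠ piv j' := by
    intro j j' hlt he
    set c := y (x j') (piv j') / y (x j) (piv j) with hc
    have hy : ∀ i, y (x j' - c • x j) i = y (x j') i - c * y (x j) i := fun i => by
      simp [y, Matrix.mulVec_sub, Matrix.mulVec_smul]
    have hmem : x j' - c • x j ∈ S j' := by
      refine ⟨?_, fun l hl => ?_⟩
      · simp [(hxS j).2 j' hlt, (hxS j').1]
      · simp [(hxS j).2 l (hlt.trans hl), (hxS j').2 l hl]
    obtain ⟨i', hle, hne⟩ := hpmax j' _ hmem
    rw [hy] at hne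
    refine hne ?_
    rcases hle.lt_or_eq with h | h
    · rw [(hpiv j').2 i' h, (hpiv j).2 i' (he ▸ h), mul_zero, sub_zero]
    · rw [hκ h, hc, ← he, div_mul_cancel₀ _ (hpiv j).1, sub_self]
  have hinj : Function.Injective piv := by
    intro j j' he
    rcases lt_trichotomy j j' with h | h | h
    · exact absurd he (hinj' _ _ h)
    · exact h
    · exact absurd he.symm (hinj' _ _ h)
  let b : G r := ⟨Matrix.of fun i j => x j i, by
    refine (Matrix.det_of_isUpperTriangular (M := Matrix.of fun i j => x j i)
      fun i j hij => (hxS j).2 i hij).trans ?_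
    exact Finset.prod_eq_one fun j _ => (hxS j).1⟩
  refine ⟨Equiv.ofBijective piv (Finite.injective_iff_bijective.mp hinj), b,
    mem_borel_iff.mpr fun i j hij => (hxS j).2 i hij, fun i j hij => ?_⟩
  rw [mat_mul_apply]
  exact (hpiv j).2 i hij

/-- The limits of a point of `G/B` under the one-parameter subgroups in an open chamber. -/
theorem exists_limit_fixedPoint {r : ℕ} {α : Type*} [LinearOrder α] {κ : Fin (r + 1) → α}
    (hκ : Function.Injective κ) (g : G r) :
    ∃ u : Weyl r, ∀ (β : Fin (r + 1) → ℝ) (hβ : ∑ i, β i = 0),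
      (∀ i j, κ j < κ i → β j < β i) → ∃ m ∈ monomial u, ∃ h : ℝ → G r,
        Tendsto h atTop (𝓝 m) ∧ ∀ s, (h s : FlagVariety (∅ : Set (Fin r))) =
          oneParam β hβ s • (g : FlagVariety (∅ : Set (Fin r))) := by
  obtain ⟨u, b, hb, hpiv⟩ := exists_pivots hκ g
  refine ⟨u, fun β hβ hmono => ?_⟩
  have hU := weylLift_mem_monomial u
  set U := weylLift u
  set n := g * b * U⁻¹ with hn
  have hnU : n * U = g * b := by rw [hn]; group
  -- So `n` is triangular for the order `κ`, and conjugation by the one-parameter subgroup contracts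
  -- it to its diagonal.
  have hn0 : ∀ i j, κ i < κ j → mat n i j = 0 := by
    intro i j hij
    have e := mul_monomial_apply hU n i (u⁻¹ j)
    rw [hnU, hpiv i (u⁻¹ j) (by rwa [weyl_apply_inv])] at e
    have h2 := monomial_apply_ne_zero hU (u⁻¹ j)
    rw [weyl_apply_inv] at e h2
    exact (mul_eq_zero.mp e.symm).resolve_right h2
  let c : ℝ → G r := fun s => (oneParam β hβ s).1 * n * (oneParam β hβ s).1⁻¹
  have hentry : ∀ s i j, mat (c s) i j = mat n i j * (Real.exp (-(s * (β i - β j))) : ℂ) := by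
    intro s i j
    have h1 := mul_monomial_apply (mem_monomial_one_iff.mpr (oneParam β hβ s).2) (c s) i j
    have h2 : c s * (oneParam β hβ s).1 = (oneParam β hβ s).1 * n := by
      simp only [c]; group
    rw [h2, torus_mul_apply, Equiv.Perm.one_apply, oneParam_apply, oneParam_apply] at h1
    have h3 : (Real.exp (-(s * β j)) : ℂ) ≠ 0 := by
      exact_mod_cast (Real.exp_pos _).ne'
    rw [← mul_left_inj' h3, ← h1, mul_assoc, ← Complex.ofReal_mul, ← Real.exp_add, mul_comm]
    congr 3
    ring
  have hlim : Tendsto (fun s => mat (c s)) atTop (𝓝 (Matrix.diagonal fun i => mat n i i)) := by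
    refine tendsto_pi_nhds.mpr fun i => tendsto_pi_nhds.mpr fun j => ?_
    simp only [hentry]
    by_cases hij : i = j
    · subst hij
      simp
    · rw [Matrix.diagonal_apply_ne _ hij]
      rcases lt_or_gt_of_ne (hκ.ne hij) with h | h
      · simp [hn0 i j h]
      · have hpos : 0 < β i - β j := sub_pos.mpr (hmono i j h)
        have h1 : Tendsto (fun s : ℝ => Real.exp (-(s * (β i - β j)))) atTop (𝓝 0) :=
          Real.tendsto_exp_neg_atTop_nhds_zero.comp (tendsto_id.atTop_mul_const hpos)
        simpa using ((Complex.continuous_ofReal.tendsto 0).comp h1).const_mul (mat n i j)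
  have hdet : (Matrix.diagonal fun i => mat n i i).det = 1 := by
    refine tendsto_nhds_unique ((continuous_id.matrix_det.tendsto _).comp hlim) ?_
    refine tendsto_const_nhds.congr fun s => ?_
    exact (c s).2.symm
  let d : G r := ⟨Matrix.diagonal fun i => mat n i i, hdet⟩
  have hd : d ∈ monomial 1 := fun i j hij => Matrix.diagonal_apply_ne _ hij
  have hcd : Tendsto c atTop (𝓝 d) :=
    (Topology.IsInducing.subtypeVal.tendsto_nhds_iff).mpr hlim
  refine ⟨d * U, by simpa using mul_mem_monomial hd hU, fun s => c s * U,
    hcd.mul_const U, fun s => ?_⟩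
  -- The extra torus factor in `c s` becomes a torus factor on the right of `U`, which is invisible
  -- in `G/B`.
  have e : c s * U = (oneParam β hβ s).1 * g * (b * (U⁻¹ * (oneParam β hβ s).1⁻¹ * U)) := by
    calc c s * U = (oneParam β hβ s).1 * (n * U) * (U⁻¹ * (oneParam β hβ s).1⁻¹ * U) := by
          simp only [c]; group
      _ = _ := by rw [hnU]; group
  rw [smul_mk]
  beta_reduce
  rw [e]
  refine QuotientGroup.mk_mul_of_mem _ (mul_mem hb (torus_le_borel r ?_))
  rw [← mem_monomial_one_iff]
  have h1 : ((oneParam β hβ s).1)⁻¹ ∈ monomial 1 := inv_mem (oneParam β hβ s).2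
  have := mul_mem_monomial (mul_mem_monomial (inv_mem_monomial hU) h1) hU
  simpa using this

/-! ### The cones -/

/-- The initial segment is the unique set of its size whose sum of indices is minimal. -/
theorem apply_le_of_sum_le {r : ℕ} {y : Weyl r} {k : Fin (r + 1)} {c : ℝ}
    (h : ∑ l, ((if y l ≤ k then 1 else 0 : ℝ) - if l ≤ k then 1 else 0) * ((l : ℝ) - c) ≤ 0) :
    ∀ l ≤ k, y l ≤ k := by
  have h0 : ∑ l, ((if y l ≤ k then 1 else 0 : ℝ) - if l ≤ k then 1 else 0) = 0 := by
    rw [Finset.sum_sub_distrib, Equiv.sum_comp y fun l => (if l ≤ k then 1 else 0 : ℝ), sub_self]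
  -- The coefficients sum to zero, so `c` may be replaced by `k + 1/2`, midway between the segment
  -- and its complement. Then every term is non-negative, and positive wherever the coefficient is
  -- nonzero.
  set F : Fin (r + 1) → ℝ := fun l =>
    ((if y l ≤ k then 1 else 0 : ℝ) - if l ≤ k then 1 else 0) * ((l : ℝ) - k - 1 / 2) with hF
  have h1 : ∑ l, F l ≤ 0 := by
    have e : ∑ l, F l =
        ∑ l, ((if y l ≤ k then 1 else 0 : ℝ) - if l ≤ k then 1 else 0) * ((l : ℝ) - c) +
        (∑ l, ((if y l ≤ k then 1 else 0 : ℝ) - if l ≤ k then 1 else 0)) * (c - k - 1 / 2) := by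
      rw [Finset.sum_mul, ← Finset.sum_add_distrib]
      exact Finset.sum_congr rfl fun l _ => by rw [hF]; ring
    rw [e, h0, zero_mul, add_zero]
    exact h
  have hcast : ∀ l : Fin (r + 1), l ≤ k → (l : ℝ) ≤ k := fun l hl => by exact_mod_cast hl
  have hpos : ∀ l ∈ Finset.univ, 0 ≤ F l := by
    intro l _
    rw [hF]
    beta_reduce
    by_cases hl : l ≤ k
    · have := hcast l hl
      split_ifs <;> nlinarith
    · have : (k : ℝ) + 1 ≤ l := by exact_mod_cast (not_le.mp hl)
      split_ifs <;> nlinarith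
  have hz := (Finset.sum_eq_zero_iff_of_nonneg hpos).mp (h1.antisymm (Finset.sum_nonneg hpos))
  intro l hl
  by_contra hy
  have h2 := hz l (Finset.mem_univ l)
  have := hcast l hl
  rw [hF] at h2
  simp only [hy, hl, if_true, if_false] at h2
  linarith

theorem sum_minorWeight_sub {r : ℕ} (k : Fin r) (u v : Weyl r) (c : ℝ) :
    ∑ i, ((minorWeight k u - minorWeight k v) i : ℝ) * (((v⁻¹ i : Fin (r + 1)) : ℝ) - c) =
      ∑ l, ((if (u⁻¹ * v) l ≤ k.castSucc then 1 else 0 : ℝ) - if l ≤ k.castSucc then 1 else 0) *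
        ((l : ℝ) - c) := by
  rw [← Equiv.sum_comp v]
  refine Finset.sum_congr rfl fun l _ => ?_
  simp only [Pi.sub_apply, minorWeight, weyl_inv_apply, Int.cast_sub, Int.cast_ite, Int.cast_one,
    Int.cast_zero, Equiv.Perm.mul_apply]
  rfl

/-- For small `ε > 0` the vector `a + ε c` is ordered like the pairs `(aᵢ, cᵢ)`. -/
theorem eventually_lt_of_toLex_lt {ι : Type*} [Finite ι] (a c : ι → ℝ) :
    ∀ᶠ ε in 𝓝[>] (0 : ℝ), ∀ i j, toLex (a j, c j) < toLex (a i, c i) →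
      a j + ε * c j < a i + ε * c i := by
  refine eventually_all.mpr fun i => eventually_all.mpr fun j => ?_
  by_cases h : toLex (a j, c j) < toLex (a i, c i)
  · rcases (Prod.Lex.toLex_lt_toLex).mp h with h1 | ⟨h1, h2⟩
    · have hc : ∀ l, Tendsto (fun ε : ℝ => a l + ε * c l) (𝓝[>] 0) (𝓝 (a l)) := fun l => by
        have : Continuous fun ε : ℝ => a l + ε * c l := by fun_prop
        simpa using (this.tendsto 0).mono_left nhdsWithin_le_nhds
      filter_upwards [(hc j).eventually_lt (hc i) h1] with ε hε _ using hε
    · filter_upwards [self_mem_nhdsWithin] with ε hε _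
      rw [show a j = a i from h1]
      exact (add_lt_add_iff_left _).mpr (mul_lt_mul_of_pos_left h2 hε)
  · exact Eventually.of_forall fun _ h' => absurd h' h

theorem sum_mul_add_mul {ι : Type*} [Fintype ι] (m a c : ι → ℝ) (ε : ℝ) :
    ∑ i, m i * (a i + ε * c i) = ∑ i, m i * a i + ε * ∑ i, m i * c i := by
  rw [Finset.mul_sum, ← Finset.sum_add_distrib]
  exact Finset.sum_congr rfl fun i _ => by ring

theorem fixedPoint_eq_of_mem_lifts {r : ℕ} {J : Set (Fin r)} {w u v : Weyl r}
    (h : u ∈ lifts J w v) : fixedPoint J u = fixedPoint J v :=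
  mk_monomial_eq (weylLift_mem_monomial u) (weylLift_mem_monomial v) h.2

section Cones

variable {r : ℕ} {J : Set (Fin r)} {w : Weyl r}

theorem fanMap_mem_orbitCone {g : G r} (hg : g ∈ cell w) (hw : w ∈ minCosetReps J)
    (hd : schubert J w ⊆ closure (MulAction.orbit (torus r) (g : FlagVariety J)))
    (hM : charLattice (schubert J w) ≤ charLattice (schubert (∅ : Set (Fin r)) w)) {u v : Weyl r}
    (hu : u ∈ lifts J w v) {ν : FanSpace (schubert (∅ : Set (Fin r)) w)}
    (hν : ν ∈ orbitCone (schubert ∅ w) (fixedPoint ∅ u)) :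
    fanMap hM ν ∈ orbitCone (schubert J w) (fixedPoint J v) := by
  intro χ hχ
  have hgB := mk_mem_schubert ∅ hg
  rw [← fixedPoint_eq_of_mem_lifts hu] at hχ
  exact hν ⟨χ.1, hM χ.2⟩ (isRegularChar_pullback (fun z hz => proj_mem_schubert J hz)
    (orbit_subset_schubert hgB) (schubert_subset_closure_orbit hw hg hd)
    (fixedPoint_mem_schubert ∅ hu.1) hd hχ)

/-- The element `u` is the limit of the generic point in the direction of `ν`, with ties broken by
`v`. -/
theorem exists_mem_lifts_mem_orbitCone {g : G r} (hg : g ∈ cell w) (hw : w ∈ minCosetReps J)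
    (hd : schubert J w ⊆ closure (MulAction.orbit (torus r) (g : FlagVariety J)))
    (hM : charLattice (schubert (∅ : Set (Fin r)) w) ≤ charLattice (schubert J w)) {v : Weyl r}
    (hv : BruhatLE v w) {ν : FanSpace (schubert J w)}
    (hν : ν ∈ orbitCone (schubert J w) (fixedPoint J v)) :
    ∃ u ∈ lifts J w v, fanMap hM ν ∈ orbitCone (schubert ∅ w) (fixedPoint ∅ u) := by
  obtain ⟨a, ha0, ha⟩ := exists_coordinates ν
  have hgB := mk_mem_schubert (∅ : Set (Fin r)) hg
  have hgP := mk_mem_schubert J hg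
  have hdB := schubert_subset_closure_orbit hw hg hd
  have hoB := orbit_subset_schubert hgB
  have hoP := orbit_subset_schubert hgP
  set q : ℝ := (∑ i : Fin (r + 1), (i : ℝ)) / (r + 1) with hq
  -- Subtracting the mean `q` makes the perturbation a direction in the Lie algebra of `T`;
  -- injectivity of `v⁻¹` breaks all ties in `a`.
  let c : Fin (r + 1) → ℝ := fun i => ((v⁻¹ i : Fin (r + 1)) : ℝ) - q
  have hc0 : ∑ i, c i = 0 := by
    have hr : (r : ℝ) + 1 ≠ 0 := by positivity
    simp only [c, Finset.sum_sub_distrib,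
      Equiv.sum_comp (v⁻¹) fun i : Fin (r + 1) => (i : ℝ), Finset.sum_const, Finset.card_univ,
      Fintype.card_fin, nsmul_eq_mul, Nat.cast_add, Nat.cast_one, hq]
    field_simp
    ring
  have hκ : Function.Injective fun i => toLex (a i, c i) := by
    intro i j hij
    have h2 : c i = c j := (Prod.mk.inj (toLex.injective hij)).2
    have h3 : ((v⁻¹ i : Fin (r + 1)) : ℝ) = ((v⁻¹ j : Fin (r + 1)) : ℝ) := sub_left_inj.mp h2
    exact (v⁻¹).injective (Fin.ext (by exact_mod_cast h3))
  have hβ : ∀ ε : ℝ, ∑ i, (a i + ε * c i) = 0 := fun ε => by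
    rw [Finset.sum_add_distrib, ← Finset.mul_sum, ha0, hc0, mul_zero, add_zero]
  obtain ⟨u, hu⟩ := exists_limit_fixedPoint hκ g
  have hev : ∀ᶠ ε in 𝓝[>] (0 : ℝ), ∃ m ∈ monomial u, ∃ h : ℝ → G r,
      Tendsto h atTop (𝓝 m) ∧ ∀ s, (h s : FlagVariety (∅ : Set (Fin r))) =
        oneParam (fun i => a i + ε * c i) (hβ ε) s • (g : FlagVariety (∅ : Set (Fin r))) := by
    filter_upwards [eventually_lt_of_toLex_lt a c] with ε hε using hu _ (hβ ε) hε
  have hfix : ∀ (J' : Set (Fin r)), ∀ m ∈ monomial u, (m : FlagVariety J') = fixedPoint J' u :=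
    fun J' m hm => mk_monomial_eq hm (weylLift_mem_monomial u) rfl
  have huB : fixedPoint ∅ u ∈ schubert (∅ : Set (Fin r)) w := by
    obtain ⟨ε, m, hm, h, hlim, hh⟩ := hev.exists
    rw [← hfix ∅ m hm]
    refine isClosed_closure.mem_of_tendsto
      ((QuotientGroup.continuous_mk.tendsto m).comp hlim) (Eventually.of_forall fun s => ?_)
    rw [Function.comp_apply, hh]
    exact smul_mem_schubert _ hgB
  have huw : BruhatLE u w := bruhatLE_of_fixedPoint_mem huB
  have huP := fixedPoint_mem_schubert J huw
  have hvP := fixedPoint_mem_schubert J hv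
  have hcone : ∀ m : Fin (r + 1) → ℤ,
      IsRegularChar (schubert ∅ w) (fixedPoint (∅ : Set (Fin r)) u) (monomialChar m) →
        0 ≤ ∑ i, (m i : ℝ) * a i := by
    intro m hm
    have hc : Continuous fun ε : ℝ => ∑ i, (m i : ℝ) * (a i + ε * c i) := by fun_prop
    have hlim : Tendsto (fun ε : ℝ => ∑ i, (m i : ℝ) * (a i + ε * c i)) (𝓝[>] 0)
        (𝓝 (∑ i, (m i : ℝ) * a i)) := by
      simpa using (hc.tendsto 0).mono_left nhdsWithin_le_nhds
    refine ge_of_tendsto hlim ?_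
    filter_upwards [hev] with ε ⟨n, hn, h, hl, hh⟩
    rw [← hfix ∅ n hn] at hm huB
    exact nonneg_of_isRegularChar hoB hdB huB (hβ ε) hl hh hm
  have hmem : u ∈ lifts J w v := by
    refine ⟨huw, QuotientGroup.eq.mpr (mem_weylParabolic_iff.mpr fun k hk => ?_)⟩
    refine apply_le_of_sum_le (c := q) ?_
    rw [← sum_minorWeight_sub]
    obtain ⟨hχ1, hχ2⟩ := minor_quotient_regular hgP hd huP hvP hk
    have h1 : 0 ≤ ∑ i, ((minorWeight k u - minorWeight k v) i : ℝ) * a i := by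
      rw [← ha _ hχ1]
      exact hν _ hχ2
    -- The perturbed path projects to `G/P` and ends at `uP`, so the inverse quotient of minors can
    -- be tested on it.
    obtain ⟨ε, ⟨n, hn, h, hl, hh⟩, hε⟩ := (hev.and self_mem_nhdsWithin).exists
    have hχ3 := (minor_quotient_regular hgP hd hvP huP hk).2
    rw [← hfix J n hn] at hχ3 huP
    have h2 := nonneg_of_isRegularChar hoP hd huP (hβ ε) hl
      (fun s => congrArg (proj J) (hh s)) hχ3
    have h3 : ∑ i, ((minorWeight k v - minorWeight k u) i : ℝ) * (a i + ε * c i) =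
        -(∑ i, ((minorWeight k u - minorWeight k v) i : ℝ) * a i +
          ε * ∑ i, ((minorWeight k u - minorWeight k v) i : ℝ) * c i) := by
      rw [← sum_mul_add_mul, ← Finset.sum_neg_distrib]
      refine Finset.sum_congr rfl fun i _ => ?_
      simp only [Pi.sub_apply, Int.cast_sub]
      ring
    rw [h3] at h2
    have h4 : ε * ∑ i, ((minorWeight k u - minorWeight k v) i : ℝ) * c i ≤ 0 := by linarith
    exact nonpos_of_mul_nonpos_right h4 hε
  refine ⟨u, hmem, fun χ hχ => ?_⟩
  obtain ⟨χ, hχM⟩ := χ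
  obtain ⟨m, hm⟩ := hχM.1
  obtain rfl := eq_monomialChar hm
  exact (hcone m hχ).trans_eq (ha m (hM hχM)).symm

end Cones

end ToricSchubert

/-- The two fan spaces become one space only through `hM`; `fanMap hM.le` is this identification. -/
theorem mainTheorem3 (r : ℕ) (J : Set (Fin r)) (w : ToricSchubert.Weyl r)
    (hw : w ∈ ToricSchubert.minCosetReps J)
    (htoric : ToricSchubert.IsToric (ToricSchubert.schubert J w)) :
    ToricSchubert.IsToric (ToricSchubert.schubert (∅ : Set (Fin r)) w) ∧
    ∃ hM : ToricSchubert.charLattice (ToricSchubert.schubert J w) =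
        ToricSchubert.charLattice (ToricSchubert.schubert (∅ : Set (Fin r)) w),
      ∀ v ∈ ToricSchubert.minCosetReps J, ToricSchubert.BruhatLE v w →
        ToricSchubert.orbitCone (ToricSchubert.schubert J w) (ToricSchubert.fixedPoint J v) =
          ⋃ u ∈ ToricSchubert.lifts J w v,
            ToricSchubert.fanMap hM.le ''
              ToricSchubert.orbitCone (ToricSchubert.schubert (∅ : Set (Fin r)) w)
                (ToricSchubert.fixedPoint ∅ u) := by
  obtain ⟨g, hg, hd, -⟩ := ToricSchubert.exists_generic_of_isToric htoric
  refine ⟨ToricSchubert.isToric_schubert_borel hw htoric,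
    ToricSchubert.charLattice_schubert_eq hw, fun v _ hv => Set.Subset.antisymm ?_ ?_⟩
  · intro ν hν
    obtain ⟨u, hu, hνu⟩ := ToricSchubert.exists_mem_lifts_mem_orbitCone hg hw hd
      (ToricSchubert.charLattice_schubert_eq hw).ge hv hν
    -- Restricting along `hM.ge` and back along `hM.le` returns `ν` by definition.
    exact Set.mem_biUnion hu ⟨_, hνu, rfl⟩
  · refine Set.iUnion₂_subset fun u hu => ?_
    rintro _ ⟨ν, hν, rfl⟩
    exact ToricSchubert.fanMap_mem_orbitCone hg hw hd _ hu hν
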